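/- Let $d\in\{1,2\}$, let $g$ be a real symmetric positive definite $d\times d$ matrix, $B$ a real antisymmetric $d\times d$ matrix, and $V_d=\sqrt{\det g}$. For $\tau=\tau_1+i\tau_2$ in the upper half-plane put $$Z_{d,d}(g,B;\tau)=V_d\sum_{m,n\in\mathbb Z^d}\exp\Big(-\frac{\pi}{\tau_2}\sum_{i,j}(m^i+\tau n^i)(g_{ij}+B_{ij})(m^j+\bar\tau n^j)\Big),\qquad I_d=2\pi\int_{\mathcal F}\frac{d\tau_1\,d\tau_2}{\tau_2^2}\,Z_{d,d}(g,B;\tau),$$ where $\mathcal F=\{|\tau|\ge 1,\ |\tau_1|\le \tfrac12\}$. The $SO(d,d,\mathbb Z)$ Eisenstein series in the spinor and conjugate spinor representations are $$\mathcal E_{\mathbf S;s}=\sum_{0\ne m\in\mathbb Z^d}\Big[\frac1{V_d}\sum_{i,j}m^i g_{ij}m^j\Big]^{-s},\qquad \mathcal E_{\mathbf C;s}=\sum_{(m,\,m^{ij})\neq 0}\Big[\frac1{V_d}\Big(\big(m+\tfrac12\sum_{i,j} m^{ij}B_{ij}\big)^2+\tfrac12\sum_{i,j,k,l} m^{ij}g_{ik}g_{jl}m^{kl}\Big)\Big]^{-s},$$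 the second sum running over $m\in\mathbb Z$ and antisymmetric integer $d\times d$ matrices $(m^{ij})$, not both zero (for $d\le 2$ the quadratic half-BPS constraints on the charges are empty). Then $$I_d=2\,\mathcal E_{\mathbf S;s=1}+2\,\mathcal E_{\mathbf C;s=1}.$$ For $d=1$ the integral and both series at $s=1$ converge absolutely and the equality is exact. For $d=2$ the integral and both series diverge logarithmically, both sides are regularized, and the equality holds up to an additive constant independent of $g$ and $B$. Here the regularized $I_2$ is the limit, as $L\to\infty$, of the integral over $\mathcal F\cap\{\tau_2\le L\}$ minus its divergent term proportional to $\log L$. The series converge absolutely for $\operatorname{Re}s>1$ and continue meromorphically to a neighbourhood of $s=1$ with at most a simple pole there; their regularized values at $s=1$ are the values at $s=1$ of the continuation minus its polar term, which is proportional to $1/(s-1)$. -/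

import Mathlib

open Filter Topology MeasureTheory

noncomputable section

namespace OneLoop

/-- The volume `V_d = √(det g)` of the torus `T^d` with metric `g`. -/
def vol {d : ℕ} (g : Matrix (Fin d) (Fin d) ℝ) : ℝ := √g.det

/-- The partition function (theta function) of the even self-dual lattice of the torus with
metric `g` and two-form background `B`:
`Z_{d,d}(g, B; τ) = V_d ∑_{m, n ∈ ℤ^d} exp(-(π/τ₂) (m^i + τ n^i) (g_ij + B_ij) (m^j + τ̄ n^j))`. -/
def Z {d : ℕ} (g B : Matrix (Fin d) (Fin d) ℝ) (τ : UpperHalfPlane) : ℂ :=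
  (vol g : ℂ) * ∑' p : (Fin d → ℤ) × (Fin d → ℤ),
    Complex.exp (-((Real.pi / τ.im : ℝ) : ℂ) * ∑ i, ∑ j,
      ((p.1 i : ℂ) + (τ : ℂ) * (p.2 i : ℂ)) * ((g i j + B i j : ℝ) : ℂ) *
        ((p.1 j : ℂ) + (starRingEnd ℂ) (τ : ℂ) * (p.2 j : ℂ)))

/-- The one-loop modular integral `I_d = 2π ∫_𝓕 (d²τ / τ₂²) Z_{d,d}(g, B; τ)` over the standard
fundamental domain `𝓕 = {|τ| ≥ 1, |τ₁| ≤ 1/2}` of the modular group. The measure on the upper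
half-plane is `dτ₁ dτ₂ / τ₂²`. -/
def modularIntegral {d : ℕ} (g B : Matrix (Fin d) (Fin d) ℝ) : ℂ :=
  2 * (Real.pi : ℂ) * ∫ τ in ModularGroup.fd, Z g B τ

/-- The one-loop integral with an infrared cut-off: integration is over the points of `𝓕` with
`τ₂ ≤ L`. -/
def modularIntegralUpTo {d : ℕ} (g B : Matrix (Fin d) (Fin d) ℝ) (L : ℝ) : ℂ :=
  2 * (Real.pi : ℂ) * ∫ τ in ModularGroup.truncatedFundamentalDomain L, Z g B τ

/-- `a` is the value of the logarithmically divergent integral `I_d`, regularized by the cut-off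
`τ₂ ≤ L`: the integral up to `L` is `r log L + a + o(1)` as `L → ∞`
(`r`, and hence `a`, are unique). -/
def IsRegularizedIntegral {d : ℕ} (g B : Matrix (Fin d) (Fin d) ℝ) (a : ℂ) : Prop :=
  (∀ L : ℝ, IntegrableOn (Z g B) (ModularGroup.truncatedFundamentalDomain L)) ∧
  ∃ r : ℂ, Tendsto (fun L : ℝ => modularIntegralUpTo g B L - r * (Real.log L : ℂ)) atTop (𝓝 a)

/-- Nonzero charges `m^i` in the spinor representation of `SO(d,d,ℤ)`, for `d ≤ 2`. The spinor
charges are the wrapping numbers `m^{[1]}, m^{[3]}, …` on odd cycles of the torus; those of rank at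
least `3` vanish for `d ≤ 2`, and the half-BPS condition, which antisymmetrizes at
least four indices, is empty. -/
def SpinorCharge (d : ℕ) : Type := {m : Fin d → ℤ // m ≠ 0}

/-- `𝓜²(S) = (1/V_d) m^i g_ij m^j`, the mass formula in the spinor representation, for `d ≤ 2`
(there the dressed charge is `m̃^i = m^i`). -/
def spinorMass {d : ℕ} (g : Matrix (Fin d) (Fin d) ℝ) (m : SpinorCharge d) : ℝ :=
  (1 / vol g) * ∑ i, ∑ j, (m.1 i : ℝ) * g i j * (m.1 j : ℝ)

/-- Nonzero charges `(m, m^{ij})`, `m^{ij} = -m^{ji}`, in the conjugate spinor representation of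
`SO(d,d,ℤ)`, for `d ≤ 2`. These charges are the wrapping numbers `m, m^{[2]}, m^{[4]}, …` on even
cycles of the torus; those of rank at least `4` vanish for `d ≤ 2`, and the half-BPS condition,
which antisymmetrizes at least four indices, is empty. -/
def ConjSpinorCharge (d : ℕ) : Type :=
  {m : ℤ × Matrix (Fin d) (Fin d) ℤ // m.2.transpose = -m.2 ∧ m ≠ 0}

/-- `𝓜²(C) = (1/V_d) [m̃² + ½ m^{ij} g_ik g_jl m^{kl}]` with the dressed charge
`m̃ = m + ½ m^{ij} B_ij`, the mass formula in the conjugate spinor representation, for `d ≤ 2`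
(there the dressed rank-two charge is `m^{ij}`). -/
def conjSpinorMass {d : ℕ} (g B : Matrix (Fin d) (Fin d) ℝ) (m : ConjSpinorCharge d) : ℝ :=
  (1 / vol g) *
    (((m.1.1 : ℝ) + (1 / 2) * ∑ i, ∑ j, (m.1.2 i j : ℝ) * B i j) ^ 2 +
      (1 / 2) * ∑ i, ∑ j, ∑ k, ∑ l,
        (m.1.2 i j : ℝ) * g i k * g j l * (m.1.2 k l : ℝ))

/-- General term of an Eisenstein series: `[𝓜²]^{-s}`. -/
def eisTerm {X : Type} (M : X → ℝ) (s : ℂ) (m : X) : ℂ := (M m : ℂ) ^ (-s)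

/-- The Eisenstein series `∑_m [𝓜²(m)]^{-s}`, summed over the nonzero charges. -/
def eis {X : Type} (M : X → ℝ) (s : ℂ) : ℂ := ∑' m : X, eisTerm M s m

/-- `a` is the value at order `s = 1` of the Eisenstein series `∑_m [𝓜²(m)]^{-s}`, which converges
absolutely for `Re s > 1`: near `s = 1` the series continues meromorphically as `r/(s-1) + F(s)` with
`F` analytic, and `a = F(1)` is what remains at `s = 1` once the pole is subtracted
(`r` and `F(1)` are unique). -/
def IsRegularizedEisAtOne {X : Type} (M : X → ℝ) (a : ℂ) : Prop :=
  (∀ s : ℂ, 1 < s.re → Summable (eisTerm M s)) ∧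
  ∃ (r : ℂ) (F : ℂ → ℂ), AnalyticAt ℂ F 1 ∧
    (∀ᶠ s in 𝓝 (1 : ℂ), 1 < s.re → eis M s = r / (s - 1) + F s) ∧ F 1 = a

end OneLoop

end

/-! ### Hyperbolic measure, the strip, and the double cover of the upper half-plane by translates of
the fundamental domain. -/

noncomputable section

namespace OneLoop

open UpperHalfPlane ModularGroup Set
open scoped MatrixGroups

/-! The zero vector of the lattice contributes `V` times the area `π/3` of the fundamental domain.
Every other lattice vector has a nonzero row `(m, n)`, an integer multiple of a coprime pair, i.e.
of a bottom row in `SL(2,ℤ)`. The lattice sum is thus a Poincaré series over `±Γ_∞ \ SL(2,ℤ)`, and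
its integral unfolds to the strip `|τ₁| ≤ 1/2` (`unfold_coprimePair`).

For `d = 1` the strip integral is `∫ (θ(t) - 1) dt = π/3` up to scale, in the variable `t = 1/τ₂`,
and both Eisenstein series are multiples of `∑ 1/n² = π²/3` over nonzero integers.

For `d = 2` put `x + i y = (g₀₁ + i V)/g₁₁` and `b = B₀₁`. The spinor mass is the unimodular binary
form `qform x y`, the conjugate spinor mass is `qform b V`. By the Mellin transform the regularized
Eisenstein values are `π * regTheta + gammaConst` for the two forms
(`isRegularizedEisAtOne_of_qform`), where `regTheta` is the integral of the theta series minus `1/t`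
on `t < 1`.

The infrared divergence is removed by subtracting half of `τ₂ 1_{τ₂ > 1}` before unfolding: on the
fundamental domain the Poincaré series of that function is `τ₂ 1_{τ₂ > 1}` itself, whose truncated
integral is exactly `log L` (`tendsto_truncated_integral`). After unfolding, the degenerate vectors
give `regTheta x y - log V`. The nondegenerate ones lose all dependence on `x, y` and give the
Bessel part of `regTheta b V` (`integral_stripKernel_tsum`). The Chowla–Selberg expansion
`regTheta_eq` shows that this Bessel part, the `-log V` and the zero-vector term `V π/3` add up to
`regTheta b V` minus a numerical constant. So the integral is `2π (regTheta x y + regTheta b V)` up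
to a constant, which is the claim. -/

/-- Unfolding for a countable family of maps whose pieces cover the space twice. -/
theorem unfold_of_double_cover {ι α : Type*} [Countable ι] [MeasurableSpace α] {μ : Measure α}
    [SFinite μ] {s : Set α} {e : ι → α → α} (he : ∀ i, Measurable (e i))
    (hcover : ∀ A, MeasurableSet A → ∑' i, μ (e i ⁻¹' A ∩ s) = 2 * μ A)
    {h : α → ℂ} (hh : Integrable h μ) :
    IntegrableOn (fun x => ∑' i, h (e i x)) s μ ∧
      ∫ x in s, ∑' i, h (e i x) ∂μ = 2 * ∫ x, h x ∂μ := by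
  let _ : MeasurableSpace ι := ⊤
  have : MeasurableSingletonClass ι := ⟨fun _ => trivial⟩
  let F : ι × α → α := fun p => e p.1 p.2
  have hF : Measurable F := measurable_from_prod_countable_right he
  -- The covering hypothesis says exactly that counting measure times `μ|_s` pushes forward to `2
  -- μ`; both conclusions are then Fubini.
  have hmap : Measure.map F ((Measure.count : Measure ι).prod (μ.restrict s)) = (2 : NNReal) • μ := by
    ext A hA
    rw [Measure.map_apply hF hA, Measure.prod_apply (hF hA), lintegral_count]
    rw [Measure.smul_apply]
    change _ = (2 : ENNReal) * μ A
    rw [← hcover A hA]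
    refine tsum_congr fun i => ?_
    rw [Measure.restrict_apply]
    · rfl
    · exact (he i) hA
  have hint : Integrable h (Measure.map F ((Measure.count : Measure ι).prod (μ.restrict s))) := by
    rw [hmap]; exact hh.smul_measure_nnreal
  have hint' := (integrable_map_measure hint.1 hF.aemeasurable).1 hint
  have key : (fun x => ∑' i, h (e i x)) =ᵐ[μ.restrict s]
      fun x => ∫ i, h (F (i, x)) ∂Measure.count := by
    filter_upwards [hint'.prod_left_ae] with x hx
    rw [show (fun i => h (F (i, x))) = fun i => (h ∘ F) (i, x) from rfl, integral_countable hx]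
    simp [Measure.real, F]
  refine ⟨hint'.integral_prod_right.congr key.symm, ?_⟩
  rw [integral_congr_ae key, ← integral_prod_symm (fun p => h (F p)) hint',
    ← integral_map hF.aemeasurable hint.1, hmap, integral_smul_nnreal_measure]
  simp [NNReal.smul_def]

instance : Countable SL(2, ℤ) :=
  have : Countable (Matrix (Fin 2) (Fin 2) ℤ) := inferInstanceAs (Countable (Fin 2 → Fin 2 → ℤ))
  Subtype.countable

theorem measurePreserving_sl_smul (g : SL(2, ℤ)) :
    MeasurePreserving (fun z : ℍ => g • z) volume volume := by
  simp_rw [ModularGroup.sl_moeb]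
  exact measurePreserving_smul _ _

/-- Coordinates `(τ₁, τ₂)` on the upper half-plane. -/
def reIm (z : ℍ) : ℝ × ℝ := (z.re, z.im)

theorem measurableEmbedding_reIm : MeasurableEmbedding reIm :=
  Complex.measurableEquivRealProd.measurableEmbedding.comp measurableEmbedding_coe

/-- The measure `dy / y²` on the positive half-line. -/
def radial : Measure ℝ := (volume.restrict (Ioi 0)).withDensity fun y => ENNReal.ofReal (1 / y ^ 2)

instance : SFinite radial := by unfold radial; infer_instance

theorem map_reIm_volume : Measure.map reIm volume = (volume : Measure ℝ).prod radial := by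
  have h1 : Measure.map reIm (volume.comap UpperHalfPlane.coe) =
      (volume : Measure ℝ).prod (volume.restrict (Ioi 0)) := by
    have : (volume : Measure ℝ).prod ((volume : Measure ℝ).restrict (Ioi 0)) =
      (volume : Measure (ℝ × ℝ)).restrict (univ ×ˢ Ioi 0) := by
      rw [Measure.volume_eq_prod, ← Measure.prod_restrict, Measure.restrict_univ]
    rw [this]
    change Measure.map (Complex.measurableEquivRealProd ∘ UpperHalfPlane.coe) _ = _
    rw [← Measure.map_map Complex.measurableEquivRealProd.measurable measurable_coe,
      measurableEmbedding_coe.map_comap]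
    rw [← Complex.volume_preserving_equiv_real_prod.map_eq,
      Measure.restrict_map Complex.measurableEquivRealProd.measurable
        (MeasurableSet.univ.prod measurableSet_Ioi)]
    congr 2
    ext z
    constructor
    · rintro ⟨w, rfl⟩
      exact ⟨trivial, w.im_pos⟩
    · intro h
      exact ⟨⟨z, h.2⟩, rfl⟩
  rw [radial, prod_withDensity_right (by fun_prop), ← h1, volume_def]
  have h2 := measurableEmbedding_reIm
  ext A hA
  rw [Measure.map_apply h2.measurable hA, withDensity_apply _ (h2.measurable hA),
    withDensity_apply _ hA, Measure.restrict_map h2.measurable hA, h2.lintegral_map]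
  refine lintegral_congr fun z => ?_
  rw [ENNReal.ofReal]
  congr 1
  ext
  simp [reIm, sq_nonneg]

theorem measurePreserving_reIm :
    MeasurePreserving reIm volume ((volume : Measure ℝ).prod radial) :=
  ⟨measurableEmbedding_reIm.measurable, map_reIm_volume⟩

theorem radial_ae_pos : ∀ᵐ y ∂radial, 0 < y :=
  (withDensity_absolutelyContinuous _ _).ae_le (ae_restrict_mem measurableSet_Ioi)

theorem integral_radial (f : ℝ → ℂ) : ∫ y, f y ∂radial = ∫ y in Ioi 0, ((1 / y ^ 2 : ℝ) : ℂ) * f y := by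
  rw [radial, integral_withDensity_eq_integral_toReal_smul (by fun_prop) (by simp)]
  refine setIntegral_congr_fun measurableSet_Ioi fun y _ => ?_
  simp only [Complex.real_smul]
  rw [ENNReal.toReal_ofReal (by positivity)]

theorem integrable_radial_iff (f : ℝ → ℂ) :
    Integrable f radial ↔ IntegrableOn (fun y => ((1 / y ^ 2 : ℝ) : ℂ) * f y) (Ioi 0) := by
  rw [radial, integrable_withDensity_iff_integrable_smul' (by fun_prop) (by simp)]
  refine integrableOn_congr_fun (fun y _ => ?_) measurableSet_Ioi
  simp only [Complex.real_smul]
  rw [ENNReal.toReal_ofReal (by positivity)]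

theorem abs_neg_one_mul_rpow_neg_two {y : ℝ} (hy : 0 < y) :
    |(-1 : ℝ)| * y ^ ((-1 : ℝ) - 1) = 1 / y ^ 2 := by
  rw [abs_neg, abs_one, one_mul, show (-1 : ℝ) - 1 = -(2 : ℕ) by norm_num, Real.rpow_neg hy.le,
    Real.rpow_natCast, one_div]

/-- The substitution `t = 1/y` turns `dy / y²` into `dt`. Strip integrals thereby become half-line
integrals of theta functions in `t = 1/τ₂`. -/
theorem integral_radial_inv (f : ℝ → ℂ) : ∫ y, f y ∂radial = ∫ t in Ioi 0, f t⁻¹ := by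
  rw [integral_radial, ← integral_comp_rpow_Ioi (fun t => f t⁻¹) (show (-1 : ℝ) ≠ 0 by norm_num)]
  refine setIntegral_congr_fun measurableSet_Ioi fun y hy => ?_
  have hy : 0 < y := hy
  simp only [Complex.real_smul]
  rw [Real.rpow_neg_one, inv_inv, abs_neg_one_mul_rpow_neg_two hy]

theorem integrable_radial_inv (f : ℝ → ℂ) :
    Integrable f radial ↔ IntegrableOn (fun t => f t⁻¹) (Ioi 0) := by
  rw [integrable_radial_iff,
    ← integrableOn_Ioi_comp_rpow_iff (fun t => f t⁻¹) (show (-1 : ℝ) ≠ 0 by norm_num)]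
  refine integrableOn_congr_fun (fun y hy => ?_) measurableSet_Ioi
  have hy : 0 < y := hy
  simp only [Complex.real_smul]
  rw [Real.rpow_neg_one, inv_inv, abs_neg_one_mul_rpow_neg_two hy]

/-- The half-open strip `-1/2 ≤ τ₁ < 1/2`, a fundamental domain for the translations. -/
def strip : Set ℍ := {z | z.re ∈ Ico (-1 / 2 : ℝ) (1 / 2)}

theorem measurable_reIm : Measurable reIm := measurableEmbedding_reIm.measurable

theorem measurableSet_strip : MeasurableSet strip :=
  (measurable_fst.comp measurable_reIm) measurableSet_Ico

theorem map_reIm_strip : Measure.map reIm (volume.restrict strip) =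
    ((volume : Measure ℝ).restrict (Ico (-1 / 2) (1 / 2))).prod radial := by
  have : strip = reIm ⁻¹' (Ico (-1 / 2 : ℝ) (1 / 2) ×ˢ univ) := by ext; simp [strip, reIm]
  rw [this, ← Measure.restrict_map measurable_reIm (measurableSet_Ico.prod .univ), map_reIm_volume,
    ← Measure.prod_restrict, Measure.restrict_univ]

theorem integrableOn_strip_iff (f : ℝ × ℝ → ℂ) :
    IntegrableOn (fun z => f (reIm z)) strip ↔
      Integrable f (((volume : Measure ℝ).restrict (Ico (-1 / 2) (1 / 2))).prod radial) := by
  rw [← map_reIm_strip, measurableEmbedding_reIm.integrable_map_iff]; rfl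

theorem setIntegral_strip (f : ℝ × ℝ → ℂ) :
    ∫ z in strip, f (reIm z) =
      ∫ p, f p ∂(((volume : Measure ℝ).restrict (Ico (-1 / 2) (1 / 2))).prod radial) := by
  rw [← map_reIm_strip, measurableEmbedding_reIm.integral_map]

theorem integrableOn_strip_im (f : ℝ → ℂ) (hf : Integrable f radial) :
    IntegrableOn (fun z : ℍ => f z.im) strip := by
  refine (integrableOn_strip_iff fun p => f p.2).2 ?_
  exact hf.comp_snd _

theorem setIntegral_strip_im (f : ℝ → ℂ) : ∫ z in strip, f z.im = ∫ y, f y ∂radial := by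
  refine (setIntegral_strip fun p => f p.2).trans ?_
  rw [integral_fun_snd]
  simp [Measure.real]
  norm_num

theorem radial_absolutelyContinuous : radial ≪ volume :=
  (withDensity_absolutelyContinuous _ _).trans Measure.restrict_le_self.absolutelyContinuous

theorem measurableSet_fd : MeasurableSet fd := isClosed_fd.measurableSet

/-- The boundary lies on the unit circle and two vertical lines; for `τ₁ ≠ ±1/2` a vertical section
of it has at most two points. -/
theorem fd_ae_eq_fdo : (fd : Set ℍ) =ᵐ[volume] fdo := by
  refine Filter.EventuallyLE.antisymm (ae_le_set.2 ?_) (Eventually.of_forall fdo_subset_fd)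
  set N : Set (ℝ × ℝ) := {p | p.1 ^ 2 + p.2 ^ 2 = 1 ∨ |p.1| = 1 / 2}
  have hN : MeasurableSet N := by
    refine MeasurableSet.union ?_ ?_
    · exact measurableSet_eq_fun (by fun_prop) (by fun_prop)
    · exact measurableSet_eq_fun (by fun_prop) (by fun_prop)
  have hsub : fd \ fdo ⊆ reIm ⁻¹' N := by
    rintro z ⟨⟨h1, h2⟩, h3⟩
    by_contra h4
    simp only [N, mem_preimage, mem_ofPred_eq, not_or, reIm] at h4
    refine h3 ⟨lt_of_le_of_ne h1 ?_, lt_of_le_of_ne h2 h4.2⟩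
    intro h
    apply h4.1
    rw [h, Complex.normSq_apply]
    simp [sq]
  refine measure_mono_null hsub ?_
  rw [measurePreserving_reIm.measure_preimage hN.nullMeasurableSet, Measure.measure_prod_null hN]
  have : ∀ᵐ x : ℝ, x ∉ ({1 / 2, -(1 / 2)} : Set ℝ) :=
    measure_eq_zero_iff_ae_notMem.1 ((Set.toFinite _).measure_zero _)
  filter_upwards [this] with x hx
  apply radial_absolutelyContinuous
  refine measure_mono_null (t := {√(1 - x ^ 2), -√(1 - x ^ 2)}) ?_ ((Set.toFinite _).measure_zero _)
  rintro y (hy | hy)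
  · have : y ^ 2 = √(1 - x ^ 2) ^ 2 := by
      simp only at hy
      rw [Real.sq_sqrt (by nlinarith [sq_nonneg y])]
      linarith
    exact sq_eq_sq_iff_eq_or_eq_neg.1 this
  · exact absurd ((abs_eq (by norm_num)).1 hy) hx

/-- Almost every point is carried into the open fundamental domain by exactly two elements, some
`g₀` and `-g₀`; hence the factor 2. -/
theorem tsum_measure_smul_preimage_inter_fd {A : Set ℍ} (hA : MeasurableSet A) :
    ∑' g : SL(2, ℤ), volume ((fun z : ℍ => g • z) ⁻¹' A ∩ fd) = 2 * volume A := by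
  have hfdo : MeasurableSet (fdo : Set ℍ) := isOpen_fdo.measurableSet
  have h1 : ∀ g : SL(2, ℤ), volume ((fun z : ℍ => g • z) ⁻¹' A ∩ fd) =
      ∫⁻ z in A, (fdo : Set ℍ).indicator 1 (g⁻¹ • z) := by
    intro g
    have hm := (measurePreserving_sl_smul g⁻¹).measurable
    have : (fun z : ℍ => (fdo : Set ℍ).indicator (1 : ℍ → ENNReal) (g⁻¹ • z)) =
        ((fun z : ℍ => g⁻¹ • z) ⁻¹' fdo).indicator 1 := rfl
    rw [this, lintegral_indicator_one (hm hfdo), Measure.restrict_apply (hm hfdo),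
      measure_congr ((Filter.EventuallyEq.refl _ _).inter fd_ae_eq_fdo),
      ← (measurePreserving_sl_smul g).measure_preimage
        ((hm hfdo).inter hA).nullMeasurableSet]
    congr 1
    ext z
    simp [and_comm]
  simp_rw [h1]
  rw [← lintegral_tsum]
  · have hgood : ∀ᵐ z : ℍ, ∀ g : SL(2, ℤ), g • z ∈ fd → g • z ∈ fdo := by
      rw [ae_all_iff]
      intro g
      have := (measurePreserving_sl_smul g).quasiMeasurePreserving.ae fd_ae_eq_fdo.mem_iff
      filter_upwards [this] with z hz using hz.1
    have : ∀ᵐ z : ℍ, ∑' g : SL(2, ℤ), (fdo : Set ℍ).indicator (1 : ℍ → ENNReal) (g⁻¹ • z) = 2 := by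
      filter_upwards [hgood] with z hz
      obtain ⟨g₀, hg₀⟩ := exists_smul_mem_fd z
      have hg₀ := hz g₀ hg₀
      have hne : g₀⁻¹ ≠ -g₀⁻¹ := by
        intro h
        have h00 : (g₀⁻¹).1 = -(g₀⁻¹).1 := by
          conv_lhs => rw [h]
          simp
        have h0 : (g₀⁻¹).1 = 0 := by
          ext i j
          have := congrFun (congrFun h00 i) j
          simp only [Matrix.neg_apply] at this
          exact self_eq_neg.1 this
        have hd := (g₀⁻¹).2
        rw [h0] at hd
        simp at hd
      rw [tsum_eq_sum (s := {g₀⁻¹, -g₀⁻¹})]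
      · rw [Finset.sum_pair hne]
        have h2 : (-g₀⁻¹)⁻¹ • z = g₀ • z := by
          rw [inv_neg, inv_inv, ModularGroup.SL_neg_smul]
        rw [inv_inv, h2, indicator_of_mem hg₀]
        norm_num
      · intro g hg
        refine indicator_of_notMem (fun hgz => hg ?_) _
        have : (g⁻¹ * g₀⁻¹) • (g₀ • z) ∈ (fdo : Set ℍ) := by
          rwa [← mul_smul, inv_mul_cancel_right]
        rcases eq_one_or_neg_one_of_mem_fdo_mem_fdo hg₀ this with h | h
        · simp [inv_mul_eq_one.1 h]
        · have : g₀⁻¹ = -g := by rw [inv_mul_eq_iff_eq_mul] at h; rw [h]; simp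
          simp [this]
    rw [lintegral_congr_ae (ae_restrict_of_ae this)]
    simp
  · intro g
    exact ((measurable_one.indicator hfdo).comp
      (measurePreserving_sl_smul g⁻¹).measurable).aemeasurable

end OneLoop

end

/-! ### Unfolding over coprime pairs, the area of the fundamental domain, and the infrared cut-off.
-/

noncomputable section

namespace OneLoop

open UpperHalfPlane ModularGroup Set
open scoped MatrixGroups

/-- Coprime pairs of integers, the bottom rows of matrices in `SL(2,ℤ)`. -/
def CoprimePair : Type := {v : Fin 2 → ℤ // IsCoprime (v 0) (v 1)}

/-- A matrix in `SL(2,ℤ)` with given bottom row. -/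
def CoprimePair.toSL (v : CoprimePair) : SL(2, ℤ) := (bottom_row_surj v.2).choose

theorem CoprimePair.toSL_one (v : CoprimePair) (j : Fin 2) : v.toSL.1 1 j = v.1 j :=
  congrFun (bottom_row_surj v.2).choose_spec.2 j

theorem T_zpow_mul_one (k : ℤ) (g : SL(2, ℤ)) (j : Fin 2) : (T ^ k * g).1 1 j = g.1 1 j := by
  rw [Matrix.SpecialLinearGroup.coe_mul, coe_T_zpow, Matrix.mul_apply]
  simp [Fin.sum_univ_two]

/-- With equal bottom rows, `g h⁻¹` has bottom row `(0, 1)` and is therefore a translation, by its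
upper right entry. -/
theorem eq_T_zpow_mul_of_bottom_row_eq {g h : SL(2, ℤ)} (h0 : g.1 1 0 = h.1 1 0)
    (h1 : g.1 1 1 = h.1 1 1) : ∃ k : ℤ, g = T ^ k * h := by
  refine ⟨(g * h⁻¹).1 0 1, ?_⟩
  rw [← mul_inv_eq_iff_eq_mul]
  have hd := g.2
  have hd' := h.2
  rw [Matrix.det_fin_two] at hd hd'
  ext i j
  rw [coe_T_zpow]
  rw [Matrix.SpecialLinearGroup.coe_mul, Matrix.SpecialLinearGroup.coe_inv, Matrix.adjugate_fin_two]
  rw [h0, h1] at hd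
  fin_cases i <;> fin_cases j <;> simp [Matrix.mul_apply, Fin.sum_univ_two, h0, h1] <;> linarith

/-- Unfolding of a sum over coprime pairs, i.e. over `±Γ_∞ \ SL(2,ℤ)`. -/
theorem unfold_coprimePair {f : ℍ → ℂ} (hper : ∀ (k : ℤ) (z : ℍ), f (T ^ k • z) = f z)
    (hf : IntegrableOn f strip) :
    IntegrableOn (fun z => ∑' v : CoprimePair, f (v.toSL • z)) fd ∧
      ∫ z in fd, ∑' v : CoprimePair, f (v.toSL • z) = 2 * ∫ z in strip, f z := by
  -- For each bottom row exactly one matrix with that row moves `z` into the half-open strip. The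
  -- sum over rows is thus a sum over the whole group of `f` restricted to the strip, to which the
  -- double cover applies.
  have key : (fun z => ∑' v : CoprimePair, f (v.toSL • z)) =
      fun z => ∑' g : SL(2, ℤ), strip.indicator f (g • z) := by
    ext z
    have hex : ∀ v : CoprimePair, ∃! k : ℤ, T ^ k • (v.toSL • z) ∈ strip := by
      intro v
      have := existsUnique_add_zsmul_mem_Ico (one_pos : (0 : ℝ) < 1) (v.toSL • z).re (-1 / 2)
      simp only [strip, mem_ofPred_eq, re_T_zpow_smul]
      norm_num at this ⊢
      exact this
    choose k hk huniq using hex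
    have hinj : Function.Injective fun v : CoprimePair => T ^ k v * v.toSL := by
      intro v w h
      apply Subtype.ext
      ext j
      rw [← v.toSL_one, ← w.toSL_one, ← T_zpow_mul_one (k v), ← T_zpow_mul_one (k w) w.toSL]
      have h' : T ^ k v * v.toSL = T ^ k w * w.toSL := h
      rw [h']
    rw [← hinj.tsum_eq]
    · refine tsum_congr fun v => ?_
      rw [mul_smul, indicator_of_mem (hk v), hper]
    · intro g hg
      have hmem : g • z ∈ strip := by
        by_contra h
        exact hg (indicator_of_notMem h _)
      let v : CoprimePair := ⟨g.1 1, bottom_row_coprime g⟩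
      obtain ⟨m, hm⟩ := eq_T_zpow_mul_of_bottom_row_eq (g := g) (h := v.toSL)
        (v.toSL_one 0).symm (v.toSL_one 1).symm
      refine ⟨v, ?_⟩
      have : m = k v := huniq v m (by
        change T ^ m • v.toSL • z ∈ strip
        rw [← mul_smul, ← hm]; exact hmem)
      simp only [← this, ← hm]
  rw [key, ← integral_indicator measurableSet_strip]
  exact unfold_of_double_cover (fun g => (measurePreserving_sl_smul g).measurable)
    (fun A hA => tsum_measure_smul_preimage_inter_fd hA)
    ((integrable_indicator_iff measurableSet_strip).2 hf)

theorem radial_Ici {a : ℝ} (ha : 0 < a) : radial (Ici a) = ENNReal.ofReal (1 / a) := by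
  rw [radial, withDensity_apply _ measurableSet_Ici, Measure.restrict_restrict measurableSet_Ici,
    inter_eq_left.2 (Ici_subset_Ioi.2 ha), Measure.restrict_congr_set Ioi_ae_eq_Ici.symm]
  have h : ∀ y ∈ Ioi a, 1 / y ^ 2 = y ^ (-2 : ℝ) := fun y hy => by
    rw [Real.rpow_neg (ha.trans hy).le, one_div]; norm_cast
  have hi : IntegrableOn (fun y : ℝ => 1 / y ^ 2) (Ioi a) :=
    (integrableOn_congr_fun h measurableSet_Ioi).2 (integrableOn_Ioi_rpow_of_lt (by norm_num) ha)
  rw [← ofReal_integral_eq_lintegral_ofReal hi (ae_of_all _ fun y => by positivity),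
    setIntegral_congr_fun measurableSet_Ioi h, integral_Ioi_rpow_of_lt (by norm_num) ha]
  congr 1
  norm_num [Real.rpow_neg_one]

/-- Integrating `dy / y²` above the unit circle leaves `∫ dx / √(1 - x²)` over `|x| ≤ 1/2`, which is
`2 arcsin (1/2)`. -/
theorem volume_fd : volume (fd : Set ℍ) = ENNReal.ofReal (Real.pi / 3) := by
  set P : Set (ℝ × ℝ) := {p | 1 ≤ p.1 ^ 2 + p.2 ^ 2 ∧ |p.1| ≤ 1 / 2}
  have hP : MeasurableSet P := by
    refine MeasurableSet.inter (s₁ := {p : ℝ × ℝ | 1 ≤ p.1 ^ 2 + p.2 ^ 2})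
      (s₂ := {p : ℝ × ℝ | |p.1| ≤ 1 / 2}) ?_ ?_
    · exact measurableSet_le (by fun_prop) (by fun_prop)
    · exact measurableSet_le (by fun_prop) (by fun_prop)
  have hfd : (fd : Set ℍ) = reIm ⁻¹' P := by
    ext z
    simp [fd, P, reIm, Complex.normSq_apply, sq]
  rw [hfd, measurePreserving_reIm.measure_preimage hP.nullMeasurableSet, Measure.prod_apply hP]
  have hsec : ∀ x : ℝ, radial (Prod.mk x ⁻¹' P) = (Icc (-(1 / 2)) (1 / 2)).indicator
      (fun x => ENNReal.ofReal (1 / √(1 - x ^ 2))) x := by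
    intro x
    by_cases hx : x ∈ Icc (-(1 / 2) : ℝ) (1 / 2)
    · have hx' : |x| ≤ 1 / 2 := abs_le.2 hx
      have hlt : 0 < 1 - x ^ 2 := by nlinarith [hx.1, hx.2]
      rw [indicator_of_mem hx, ← radial_Ici (Real.sqrt_pos.2 hlt)]
      refine measure_congr ?_
      filter_upwards [radial_ae_pos] with y hy
      refine propext ?_
      change (1 ≤ x ^ 2 + y ^ 2 ∧ |x| ≤ 1 / 2) ↔ √(1 - x ^ 2) ≤ y
      rw [Real.sqrt_le_left hy.le]
      constructor
      · intro h; linarith [h.1]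
      · intro h; exact ⟨by linarith, hx'⟩
    · rw [indicator_of_notMem hx]
      have : Prod.mk x ⁻¹' P = ∅ := by
        ext y
        simp only [P, mem_preimage, mem_ofPred_eq, mem_empty_iff_false, iff_false, not_and]
        exact fun _ h => hx (abs_le.1 h)
      rw [this, measure_empty]
  simp_rw [hsec]
  rw [lintegral_indicator measurableSet_Icc]
  have hcont : ContinuousOn (fun x : ℝ => 1 / √(1 - x ^ 2)) (Icc (-(1 / 2)) (1 / 2)) := by
    refine continuousOn_const.div (by fun_prop) fun x hx => ?_
    exact (Real.sqrt_pos.2 (by nlinarith [hx.1, hx.2])).ne'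
  rw [← ofReal_integral_eq_lintegral_ofReal (hcont.integrableOn_Icc)
    (ae_of_all _ fun y => by positivity), integral_Icc_eq_integral_Ioc,
    ← intervalIntegral.integral_of_le (by norm_num)]
  rw [intervalIntegral.integral_eq_sub_of_hasDerivAt (f := Real.arcsin)]
  · rw [Real.arcsin_neg, show (1 / 2 : ℝ) = Real.sin (Real.pi / 6) by rw [Real.sin_pi_div_six],
      Real.arcsin_sin (by linarith [Real.pi_pos]) (by linarith [Real.pi_pos])]
    congr 1; ring
  · intro x hx
    rw [uIcc_of_le (by norm_num)] at hx
    exact Real.hasDerivAt_arcsin (by linarith [hx.1]) (by linarith [hx.2])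
  · rw [intervalIntegrable_iff_integrableOn_Icc_of_le (by norm_num)]
    exact hcont.integrableOn_Icc

theorem measureReal_fd : (volume : Measure ℍ).real fd = Real.pi / 3 := by
  rw [Measure.real, volume_fd, ENNReal.toReal_ofReal (by positivity)]

/-- The reference function `τ₂ 1_{τ₂ > 1}` subtracted in the infrared regularization. -/
def cutIm (y : ℝ) : ℝ := if 1 < y then y else 0

theorem re_ne_half_ae : ∀ᵐ z : ℍ, z.re ≠ 1 / 2 := by
  have h0 : ∀ᵐ x : ℝ, x ∉ ({1 / 2} : Set ℝ) :=
    measure_eq_zero_iff_ae_notMem.1 ((Set.toFinite _).measure_zero _)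
  have h : ∀ᵐ p : ℝ × ℝ ∂(volume : Measure ℝ).prod radial, p.1 ∉ ({1 / 2} : Set ℝ) :=
    Measure.quasiMeasurePreserving_fst.ae h0
  filter_upwards [measurePreserving_reIm.quasiMeasurePreserving.ae h] with z hz
  exact hz

theorem measurableSet_truncated (L : ℝ) : MeasurableSet (truncatedFundamentalDomain L) :=
  measurableSet_fd.inter (measurableSet_le (measurable_snd.comp measurable_reIm) measurable_const)

theorem truncated_subset_fd (L : ℝ) : truncatedFundamentalDomain L ⊆ fd := fun _ h => h.1

theorem mem_fd_of_one_lt_im {z : ℍ} (hz : 1 < z.im) (h : |z.re| ≤ 1 / 2) : z ∈ fd := by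
  refine ⟨?_, h⟩
  rw [Complex.normSq_apply]
  change 1 ≤ z.re * z.re + z.im * z.im
  nlinarith [mul_self_nonneg z.re]

/-- Above height 1 the fundamental domain is the full strip of width 1, so only `∫ dy / y` from 1 to
`L` remains. This identifies the divergent term exactly. -/
theorem setIntegral_truncated_cutIm {L : ℝ} (hL : 1 ≤ L) :
    ∫ z in truncatedFundamentalDomain L, (cutIm z.im : ℂ) = (Real.log L : ℂ) := by
  rw [← integral_indicator (measurableSet_truncated L)]
  have : (truncatedFundamentalDomain L).indicator (fun z : ℍ => (cutIm z.im : ℂ)) =ᵐ[volume]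
      strip.indicator fun z => (Ioc 1 L).indicator (fun y : ℝ => (y : ℂ)) z.im := by
    filter_upwards [re_ne_half_ae] with z hz
    by_cases h1 : 1 < z.im
    · by_cases h2 : z.im ≤ L
      · by_cases h3 : |z.re| ≤ 1 / 2
        · rw [indicator_of_mem (show z ∈ truncatedFundamentalDomain L from
            ⟨mem_fd_of_one_lt_im h1 h3, h2⟩), indicator_of_mem, indicator_of_mem (show z.im ∈ Ioc 1 L from ⟨h1, h2⟩)]
          · simp [cutIm, h1]
          · exact ⟨by linarith [(abs_le.1 h3).1], lt_of_le_of_ne (abs_le.1 h3).2 hz⟩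
        · rw [indicator_of_notMem (fun h => h3 h.1.2), indicator_of_notMem]
          intro h
          exact h3 (abs_le.2 ⟨by linarith [h.1], h.2.le⟩)
      · rw [indicator_of_notMem (fun h => h2 h.2)]
        symm
        apply indicator_apply_eq_zero.2
        intro _
        exact indicator_of_notMem (fun h => h2 h.2) _
    · have hc : cutIm z.im = 0 := if_neg h1
      rw [indicator_apply_eq_zero.2 (fun _ => by simp [hc])]
      symm
      apply indicator_apply_eq_zero.2
      intro _
      exact indicator_of_notMem (fun h => h1 h.1) _
  rw [integral_congr_ae this, integral_indicator measurableSet_strip, setIntegral_strip_im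
    (fun y => (Ioc 1 L).indicator (fun y : ℝ => (y : ℂ)) y), integral_radial]
  have h2 : (fun y : ℝ => ((1 / y ^ 2 : ℝ) : ℂ) * (Ioc 1 L).indicator (fun y : ℝ => (y : ℂ)) y) =
      (Ioc 1 L).indicator fun y : ℝ => ((y⁻¹ : ℝ) : ℂ) := by
    ext y
    by_cases hy : y ∈ Ioc 1 L
    · have : y ≠ 0 := by linarith [hy.1]
      rw [indicator_of_mem hy, indicator_of_mem hy, ← Complex.ofReal_mul]
      congr 1
      field_simp
    · simp [indicator_of_notMem hy]
  rw [h2, setIntegral_indicator measurableSet_Ioc, inter_eq_right.2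
    (show Ioc 1 L ⊆ Ioi 0 from fun y hy => show 0 < y by linarith [hy.1]), integral_complex_ofReal,
    ← intervalIntegral.integral_of_le hL, integral_inv_of_pos one_pos (by linarith), div_one]

theorem one_le_sq_add_sq_sub_abs_mul {c d : ℤ} (h : c ≠ 0 ∨ d ≠ 0) :
    1 ≤ c ^ 2 + d ^ 2 - |c * d| := by
  by_contra hlt
  have h2 : 2 * |c * d| ≤ c ^ 2 + d ^ 2 := by
    rw [abs_mul]
    nlinarith [sq_nonneg (|c| - |d|), sq_abs c, sq_abs d]
  have h3 : c ^ 2 + d ^ 2 ≤ 0 := by linarith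
  rcases h with h | h
  · nlinarith [sq_nonneg d, (sq_pos_of_ne_zero h)]
  · nlinarith [sq_nonneg c, (sq_pos_of_ne_zero h)]

theorem im_sl_smul (g : SL(2, ℤ)) (z : ℍ) :
    (g • z).im = z.im / Complex.normSq ((g.1 1 0 : ℂ) * z + (g.1 1 1 : ℂ)) := by
  rw [ModularGroup.im_smul_eq_div_normSq]
  rfl

/-- The height of `g • z` is `y / |c z + d|²`. If `y ≥ 1`, then `|c z + d|² ≥ c² y² ≥ y`. If `y <
1`, then `|z| ≥ 1` and `|re z| ≤ 1/2` give `|c z + d|² ≥ c² + d² - |c d| ≥ 1`. Either way the height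
is at most 1. -/
theorem cutIm_smul_of_mem_fd {z : ℍ} (hz : z ∈ fd) (g : SL(2, ℤ)) (hg : g.1 1 0 ≠ 0) :
    cutIm (g • z).im = 0 := by
  refine if_neg (not_lt.2 ?_)
  obtain ⟨h1, h2⟩ := hz
  rw [im_sl_smul]
  set c := g.1 1 0
  set d := g.1 1 1
  have hy := z.im_pos
  have hn : Complex.normSq ((c : ℂ) * z + (d : ℂ)) = (c * z.re + d) ^ 2 + (c * z.im) ^ 2 := by
    rw [Complex.normSq_apply]; simp; ring
  have hc1 : (1 : ℝ) ≤ (c : ℝ) ^ 2 := by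
    have : 1 ≤ c ^ 2 := sq_pos_of_ne_zero hg
    exact_mod_cast this
  rw [Complex.normSq_apply] at h1
  change 1 ≤ z.re * z.re + z.im * z.im at h1
  rw [hn, div_le_one (by nlinarith [sq_nonneg (c * z.re + d : ℝ), mul_pos hy hy])]
  by_cases hy1 : 1 ≤ z.im
  · nlinarith [sq_nonneg (c * z.re + d : ℝ)]
  · have h3 : (1 : ℝ) ≤ c ^ 2 + d ^ 2 - |(c : ℝ) * d| := by
      exact_mod_cast one_le_sq_add_sq_sub_abs_mul (c := c) (d := d) (Or.inl hg)
    have h4 : -|(c : ℝ) * d| ≤ 2 * (c * d) * z.re := by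
      have h5 : |2 * ((c : ℝ) * d) * z.re| ≤ |(c : ℝ) * d| := by
        rw [abs_mul, abs_mul, abs_two]
        nlinarith [abs_nonneg ((c : ℝ) * d)]
      linarith [neg_abs_le (2 * ((c : ℝ) * d) * z.re)]
    nlinarith

/-- On the fundamental domain only `±1` contribute to the Poincaré series of `cutIm`. -/
theorem hasSum_cutIm {z : ℍ} (hz : z ∈ fd) :
    HasSum (fun v : CoprimePair => ((1 / 2 * cutIm (v.toSL • z).im : ℝ) : ℂ)) (cutIm z.im : ℂ) := by
  -- The rows `(0, 1)` and `(0, -1)` are the only coprime rows with `c = 0`. Both preserve the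
  -- height of `z`, which accounts for the weight `1/2`.
  let a : CoprimePair := ⟨![0, 1], by simp [isCoprime_one_right]⟩
  let b : CoprimePair := ⟨![0, -1], by simp [isCoprime_zero_left]⟩
  have hab : a ≠ b := by
    intro h
    have := congrFun (congrArg Subtype.val h) 1
    simp [a, b] at this
  have hunit : ∀ v : CoprimePair, v.1 0 = 0 → v.1 1 ^ 2 = 1 → (v.toSL • z).im = z.im := by
    intro v h0 h1
    rw [im_sl_smul, v.toSL_one, v.toSL_one, h0]
    have : Complex.normSq (((0 : ℤ) : ℂ) * z + (v.1 1 : ℂ)) = ((v.1 1 ^ 2 : ℤ) : ℝ) := by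
      rw [Complex.normSq_apply]; simp; ring
    rw [this, h1]; simp
  classical
  have hs := hasSum_sum_of_ne_finset_zero (L := .unconditional _) (s := ({a, b} : Finset CoprimePair))
    (f := fun v : CoprimePair => ((1 / 2 * cutIm (v.toSL • z).im : ℝ) : ℂ)) (by
    intro v hv
    have : v.1 0 ≠ 0 := by
      intro h0
      have h1 := v.2
      rw [h0, isCoprime_zero_left, Int.isUnit_iff] at h1
      apply hv
      simp only [Finset.mem_insert, Finset.mem_singleton]
      rcases h1 with h1 | h1
      · left; apply Subtype.ext; ext j; fin_cases j <;> simp [a, h0, h1]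
      · right; apply Subtype.ext; ext j; fin_cases j <;> simp [b, h0, h1]
    rw [cutIm_smul_of_mem_fd hz v.toSL (by rwa [v.toSL_one])]
    simp)
  rw [Finset.sum_pair hab, hunit a rfl (by simp [a]), hunit b rfl (by simp [b])] at hs
  convert! hs using 1
  push_cast
  ring

end OneLoop

end

/-! ### Equivariant sums over integer pairs, and integrals of unfolded sums with and without
cut-off. -/

noncomputable section

namespace OneLoop

open UpperHalfPlane ModularGroup Set
open scoped MatrixGroups

/-- Nonzero pairs of integers. -/
abbrev NonzeroPair : Type := {r : ℤ × ℤ // r ≠ 0}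

/-- A nonzero pair `(m, n)` is a positive multiple of a coprime pair `(d, c)`, uniquely. -/
def coprimePairEquiv : ℕ × CoprimePair ≃ NonzeroPair :=
  Equiv.ofBijective
    -- The natural number `q.1` encodes the gcd `q.1 + 1`. The entries are swapped because a bottom
    -- row `(c, d)` corresponds to `d + c τ`, i.e. to `(m, n) = (d, c)` in `m + n τ`.
    (fun q => ⟨((q.1 + 1 : ℤ) * q.2.1 1, (q.1 + 1 : ℤ) * q.2.1 0), by
      intro h
      have hp : (q.1 + 1 : ℤ) ≠ 0 := by positivity
      obtain ⟨h1, h0⟩ := Prod.ext_iff.1 h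
      have h2 := q.2.2
      rw [(mul_eq_zero.1 h1).resolve_left hp, (mul_eq_zero.1 h0).resolve_left hp] at h2
      exact not_isCoprime_zero_zero h2⟩)
    (by
      constructor
      · rintro ⟨p, v⟩ ⟨p', v'⟩ h
        simp only [Subtype.mk.injEq, Prod.mk.injEq] at h
        have hgcd : ∀ (p : ℕ) (v : CoprimePair),
            Int.gcd ((p + 1 : ℤ) * v.1 1) ((p + 1 : ℤ) * v.1 0) = p + 1 := by
          intro p v
          rw [Int.gcd_mul_left, Int.gcd_comm, Int.isCoprime_iff_gcd_eq_one.1 v.2]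
          simp; omega
        have hp : p = p' := by
          have := hgcd p v
          rw [h.1, h.2, hgcd] at this
          omega
        subst hp
        have hp0 : (p + 1 : ℤ) ≠ 0 := by positivity
        congr 1
        apply Subtype.ext
        ext j
        fin_cases j
        · exact mul_left_cancel₀ hp0 h.2
        · exact mul_left_cancel₀ hp0 h.1
      · rintro ⟨⟨m, n⟩, h⟩
        have hg : 0 < Int.gcd m n := by
          rw [Int.gcd_pos_iff]
          by_contra hc
          push Not at hc
          exact h (by simp [hc.1, hc.2])
        obtain ⟨m', n', hco, hm, hn⟩ := Int.exists_gcd_one hg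
        refine ⟨⟨Int.gcd m n - 1, ⟨![n', m'], ?_⟩⟩, ?_⟩
        · rw [Int.isCoprime_iff_gcd_eq_one, Int.gcd_comm]
          exact hco
        · apply Subtype.ext
          have : ((Int.gcd m n - 1 : ℕ) : ℤ) + 1 = Int.gcd m n := by omega
          simp only [this, Matrix.cons_val_zero, Matrix.cons_val_one]
          rw [mul_comm, ← hm, mul_comm, ← hn])

/-- Equivariance turns the weight of `(p + 1, 0)` at the translate of `z` with bottom row `(c, d)`
into the weight of `(p + 1) (d, c)` at `z`, and every nonzero pair has this form once. -/
theorem hasSum_coprimePair_of_equivariant {W : ℤ → ℤ → ℍ → ℂ}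
    (hW : ∀ (g : SL(2, ℤ)) (m n : ℤ) (z : ℍ),
      W m n (g • z) = W (m * g.1 1 1 + n * g.1 0 1) (m * g.1 1 0 + n * g.1 0 0) z)
    {z : ℍ} (hsum : Summable fun r : NonzeroPair => W r.1.1 r.1.2 z) :
    HasSum (fun v : CoprimePair => ∑' p : ℕ, W (p + 1) 0 (v.toSL • z))
      (∑' r : NonzeroPair, W r.1.1 r.1.2 z) := by
  have h1 := (coprimePairEquiv.hasSum_iff).2 hsum.hasSum
  have h2 : HasSum (fun q : CoprimePair × ℕ => W (q.2 + 1) 0 (q.1.toSL • z))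
      (∑' r : NonzeroPair, W r.1.1 r.1.2 z) := by
    rw [← (Equiv.prodComm ℕ CoprimePair).hasSum_iff]
    refine h1.congr_fun ?_
    rintro ⟨p, v⟩
    change _ = W ((p + 1 : ℤ) * v.1 1) ((p + 1 : ℤ) * v.1 0) z
    simp only [Function.comp, Equiv.prodComm_apply, Prod.swap, hW, v.toSL_one]
    simp
  exact h2.prod_fiberwise fun v => (h2.summable.prod_factor v).hasSum

theorem equivariant_T_zpow {W : ℤ → ℤ → ℍ → ℂ}
    (hW : ∀ (g : SL(2, ℤ)) (m n : ℤ) (z : ℍ),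
      W m n (g • z) = W (m * g.1 1 1 + n * g.1 0 1) (m * g.1 1 0 + n * g.1 0 0) z)
    (k m : ℤ) (z : ℍ) : W m 0 (T ^ k • z) = W m 0 z := by
  rw [hW]
  simp [coe_T_zpow]

theorem integrableOn_cutIm (L : ℝ) :
    IntegrableOn (fun z : ℍ => (cutIm z.im : ℂ)) (truncatedFundamentalDomain L) := by
  have hm : Measurable fun z : ℍ => (cutIm z.im : ℂ) := by
    have : Measurable cutIm := Measurable.ite measurableSet_Ioi measurable_id measurable_const
    exact Complex.measurable_ofReal.comp (this.comp (measurable_snd.comp measurable_reIm))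
  refine IntegrableOn.of_bound (isCompact_truncatedFundamentalDomain L).measure_lt_top
    hm.aestronglyMeasurable |L| ?_
  filter_upwards [ae_restrict_mem (measurableSet_truncated L)] with z hz
  rw [Complex.norm_real, Real.norm_eq_abs, cutIm]
  split_ifs
  · rw [abs_of_pos z.im_pos]
    exact hz.2.trans (le_abs_self L)
  · simp

/-- Infrared regularization of the integral of an unfolded sum that grows like `τ₂`. -/
theorem tendsto_truncated_integral {F f : ℍ → ℂ} {A : ℂ}
    (hF : ∀ z, HasSum (fun v : CoprimePair => f (v.toSL • z)) (F z - A))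
    (hper : ∀ (k : ℤ) (z : ℍ), f (T ^ k • z) = f z)
    (hint : IntegrableOn (fun z => f z - ((1 / 2 * cutIm z.im : ℝ) : ℂ)) strip) :
    (∀ L, IntegrableOn F (truncatedFundamentalDomain L)) ∧
    Tendsto (fun L : ℝ => (∫ z in truncatedFundamentalDomain L, F z) - (Real.log L : ℂ)) atTop
      (𝓝 (A * (Real.pi / 3 : ℝ) + 2 * ∫ z in strip, (f z - ((1 / 2 * cutIm z.im : ℝ) : ℂ)))) := by
  -- The corrected summand is integrable on the strip, so its Poincaré series `G` is integrable on
  -- all of `fd`. There `F = A + G + cutIm`, and only the last term feels the cut-off as `L → ∞`.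
  obtain ⟨hG, hG2⟩ := unfold_coprimePair
    (f := fun z => f z - ((1 / 2 * cutIm z.im : ℝ) : ℂ)) (by
      intro k z; simp only [hper, im_T_zpow_smul]) hint
  set G : ℍ → ℂ := fun z => ∑' v : CoprimePair,
    (f (v.toSL • z) - ((1 / 2 * cutIm (v.toSL • z).im : ℝ) : ℂ)) with hGdef
  have hfin : volume (fd : Set ℍ) ≠ ⊤ := by rw [volume_fd]; exact ENNReal.ofReal_ne_top
  have hA : Integrable (fun _ : ℍ => A) (volume.restrict fd) := integrableOn_const hfin
  have hAG : IntegrableOn (fun z => A + G z) fd := hA.add hG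
  have hFG : ∀ z ∈ fd, F z = (A + G z) + (cutIm z.im : ℂ) := by
    intro z hz
    have := ((hF z).sub (hasSum_cutIm hz)).tsum_eq
    rw [hGdef]
    simp only [this]
    ring
  have hFL : ∀ L, EqOn F (fun z => (A + G z) + (cutIm z.im : ℂ)) (truncatedFundamentalDomain L) :=
    fun L z hz => hFG z hz.1
  have hintL : ∀ L, IntegrableOn (fun z => A + G z) (truncatedFundamentalDomain L) :=
    fun L => hAG.mono_set (truncated_subset_fd L)
  refine ⟨fun L => (integrableOn_congr_fun (hFL L) (measurableSet_truncated L)).2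
    ((hintL L).add (integrableOn_cutIm L)), ?_⟩
  have hU : (⋃ L : ℝ, truncatedFundamentalDomain L) = fd := by
    ext z
    rw [mem_iUnion]
    exact ⟨fun ⟨L, h⟩ => h.1, fun h => ⟨z.im, h, le_rfl⟩⟩
  have hlim := tendsto_setIntegral_of_monotone (s := truncatedFundamentalDomain)
    (f := fun z => A + G z) (μ := volume) measurableSet_truncated
    (fun a b hab z hz => ⟨hz.1, hz.2.trans hab⟩) (by rw [hU]; exact hAG)
  rw [hU] at hlim
  rw [integral_add hA hG, hG2, setIntegral_const, measureReal_fd,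
    Complex.real_smul, mul_comm] at hlim
  refine hlim.congr' ?_
  filter_upwards [eventually_ge_atTop 1] with L hL
  rw [setIntegral_congr_fun (measurableSet_truncated L) (hFL L),
    integral_add (hintL L) (integrableOn_cutIm L), setIntegral_truncated_cutIm hL]
  ring

/-- The modular integral of an unfolded sum that is integrable on the strip. -/
theorem integral_fd_of_unfold {F f : ℍ → ℂ} {A : ℂ}
    (hF : ∀ z, HasSum (fun v : CoprimePair => f (v.toSL • z)) (F z - A))
    (hper : ∀ (k : ℤ) (z : ℍ), f (T ^ k • z) = f z) (hint : IntegrableOn f strip) :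
    IntegrableOn F fd ∧ ∫ z in fd, F z = A * (Real.pi / 3 : ℝ) + 2 * ∫ z in strip, f z := by
  obtain ⟨hG, hG2⟩ := unfold_coprimePair hper hint
  have hfin : volume (fd : Set ℍ) ≠ ⊤ := by rw [volume_fd]; exact ENNReal.ofReal_ne_top
  have hA : Integrable (fun _ : ℍ => A) (volume.restrict fd) := integrableOn_const hfin
  have hFG : F = fun z => A + ∑' v : CoprimePair, f (v.toSL • z) := by
    ext z
    rw [(hF z).tsum_eq]; ring
  rw [hFG]
  refine ⟨hA.add hG, ?_⟩
  rw [integral_add hA hG, hG2, setIntegral_const, measureReal_fd,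
    Complex.real_smul, mul_comm]

end OneLoop

end

/-! ### Mellin transforms near `s = 1` and the cut-off function `1/t` on `t < 1`. -/

noncomputable section

namespace OneLoop

open UpperHalfPlane ModularGroup Set HurwitzZeta Asymptotics
open scoped MatrixGroups

/-- Functions on the half-line whose Mellin transform is holomorphic on `1/2 < Re s < 2`. -/
structure IsTame (f : ℝ → ℂ) : Prop where
  locallyIntegrableOn : LocallyIntegrableOn f (Ioi 0)
  isBigO_atTop : f =O[atTop] fun t : ℝ => t ^ (-2 : ℝ)
  isBigO_zero : f =O[𝓝[>] 0] fun t : ℝ => t ^ (-(1 / 2) : ℝ)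

namespace IsTame

variable {f g : ℝ → ℂ}

theorem mellinConvergent (hf : IsTame f) {s : ℂ} (h1 : 1 / 2 < s.re) (h2 : s.re < 2) :
    MellinConvergent f s :=
  mellinConvergent_of_isBigO_rpow hf.1 hf.2 h2 hf.3 h1

theorem differentiableAt_mellin (hf : IsTame f) {s : ℂ} (h1 : 1 / 2 < s.re) (h2 : s.re < 2) :
    DifferentiableAt ℂ (mellin f) s :=
  mellin_differentiableAt_of_isBigO_rpow hf.1 hf.2 h2 hf.3 h1

theorem integrableOn (hf : IsTame f) : IntegrableOn f (Ioi 0) := by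
  have := hf.mellinConvergent (s := 1) (by norm_num) (by norm_num)
  simpa [MellinConvergent] using this

theorem add (hf : IsTame f) (hg : IsTame g) : IsTame fun t => f t + g t :=
  ⟨hf.1.add hg.1, hf.2.add hg.2, hf.3.add hg.3⟩

theorem const_mul (hf : IsTame f) (c : ℂ) : IsTame fun t => c * f t :=
  ⟨hf.1.smul c, hf.2.const_mul_left c, hf.3.const_mul_left c⟩

theorem congr_ends (hf : IsTame f) (hg : LocallyIntegrableOn g (Ioi 0)) (h1 : g =ᶠ[atTop] f)
    (h2 : g =ᶠ[𝓝[>] 0] f) : IsTame g :=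
  ⟨hg, h1.trans_isBigO hf.2, h2.trans_isBigO hf.3⟩

end IsTame

theorem tendsto_mul_left_nhdsGT_zero {c : ℝ} (hc : 0 < c) :
    Tendsto (fun t : ℝ => c * t) (𝓝[>] 0) (𝓝[>] 0) := by
  refine tendsto_nhdsWithin_iff.2 ⟨?_, ?_⟩
  · have : Tendsto (fun t : ℝ => c * t) (𝓝 0) (𝓝 (c * 0)) := (continuous_const.mul continuous_id).tendsto 0
    rw [mul_zero] at this
    exact this.mono_left nhdsWithin_le_nhds
  · filter_upwards [self_mem_nhdsWithin] with t ht
    exact mul_pos hc ht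

theorem isBigO_comp_mul_left {f : ℝ → ℂ} {a c : ℝ} (hc : 0 < c) {l : Filter ℝ}
    (hl : Tendsto (fun t : ℝ => c * t) l l) (hpos : ∀ᶠ t in l, 0 < t)
    (hf : f =O[l] fun t : ℝ => t ^ a) : (fun t => f (c * t)) =O[l] fun t : ℝ => t ^ a := by
  refine (hf.comp_tendsto hl).trans ?_
  refine IsBigO.of_bound (c ^ a) ?_
  filter_upwards [hpos] with t ht
  simp only [Function.comp]
  rw [Real.mul_rpow hc.le ht.le, norm_mul, Real.norm_of_nonneg (Real.rpow_nonneg hc.le a)]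

theorem locallyIntegrableOn_comp_mul_left {f : ℝ → ℂ} {c : ℝ} (hc : 0 < c)
    (hf : LocallyIntegrableOn f (Ioi 0)) : LocallyIntegrableOn (fun t => f (c * t)) (Ioi 0) := by
  rw [locallyIntegrableOn_iff isOpen_Ioi.isLocallyClosed] at hf ⊢
  intro K hK hKc
  have h := hf ((fun t => c * t) '' K) (by
    rintro _ ⟨t, ht, rfl⟩
    exact mul_pos hc (hK ht)) (hKc.image (by fun_prop))
  have he : MeasurableEmbedding fun t : ℝ => c * t := measurableEmbedding_mulLeft₀ hc.ne'
  have h2 : IntegrableOn f ((fun t => c * t) '' K) (Measure.map (fun t => c * t) volume) := by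
    rw [Real.map_volume_mul_left hc.ne']
    rw [IntegrableOn, Measure.restrict_smul]
    exact Integrable.smul_measure h ENNReal.ofReal_ne_top
  rw [he.integrableOn_map_iff, preimage_image_eq _ he.injective] at h2
  exact h2

theorem IsTame.comp_mul_left {f : ℝ → ℂ} (hf : IsTame f) {c : ℝ} (hc : 0 < c) :
    IsTame fun t => f (c * t) :=
  ⟨locallyIntegrableOn_comp_mul_left hc hf.1,
    isBigO_comp_mul_left hc (tendsto_id.const_mul_atTop hc) (eventually_gt_atTop 0) hf.2,
    isBigO_comp_mul_left hc (tendsto_mul_left_nhdsGT_zero hc) self_mem_nhdsWithin hf.3⟩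

/-- The function `1/t` cut off at `t < 1`. -/
def cutInv (t : ℝ) : ℂ := (cutIm t⁻¹ : ℂ)

theorem cutInv_of_lt {t : ℝ} (h0 : 0 < t) (h1 : t < 1) : cutInv t = (t : ℂ)⁻¹ := by
  rw [cutInv, cutIm, if_pos ((one_lt_inv₀ h0).2 h1)]
  simp

theorem cutInv_of_ge {t : ℝ} (h1 : 1 ≤ t) : cutInv t = 0 := by
  rw [cutInv, cutIm, if_neg (not_lt.2 (inv_le_one_of_one_le₀ h1))]
  simp

theorem measurable_cutInv : Measurable cutInv := by
  have : Measurable cutIm := Measurable.ite measurableSet_Ioi measurable_id measurable_const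
  exact Complex.measurable_ofReal.comp (this.comp measurable_inv)

theorem norm_cutInv_le {t : ℝ} (ht : 0 < t) : ‖cutInv t‖ ≤ t⁻¹ := by
  rcases lt_or_ge t 1 with h | h
  · rw [cutInv_of_lt ht h, norm_inv, Complex.norm_real, Real.norm_of_nonneg ht.le]
  · rw [cutInv_of_ge h]; simp [ht.le]

theorem locallyIntegrableOn_cutInv : LocallyIntegrableOn cutInv (Ioi 0) := by
  have h : LocallyIntegrableOn (fun t : ℝ => t⁻¹) (Ioi 0) :=
    (continuousOn_inv₀.mono fun t (ht : 0 < t) => ht.ne').locallyIntegrableOn measurableSet_Ioi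
  rw [locallyIntegrableOn_iff isOpen_Ioi.isLocallyClosed] at h ⊢
  intro K hK hKc
  refine Integrable.mono' (h K hK hKc) measurable_cutInv.aestronglyMeasurable ?_
  filter_upwards [ae_restrict_mem hKc.measurableSet] with t ht using norm_cutInv_le (hK ht)

/-- The pole of the Eisenstein series comes from here alone: what is left of the theta series after
subtracting `cutInv` is tame. -/
theorem hasMellin_cutInv {s : ℂ} (hs : 1 < s.re) : HasMellin cutInv s (1 / (s - 1)) := by
  have h := hasMellin_cpow_Ioc (-1) (s := s) (by simpa using by linarith)
  have hae : (fun t : ℝ => (t : ℂ) ^ (s - 1) • (Ioc (0 : ℝ) 1).indicator (fun t : ℝ => (t : ℂ) ^ (-1 : ℂ)) t)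
      =ᵐ[volume.restrict (Ioi 0)] fun t : ℝ => (t : ℂ) ^ (s - 1) • cutInv t := by
    have h1 : ∀ᵐ t : ℝ, t ∉ ({1} : Set ℝ) :=
      measure_eq_zero_iff_ae_notMem.1 ((Set.toFinite _).measure_zero _)
    filter_upwards [ae_restrict_mem measurableSet_Ioi, ae_restrict_of_ae h1] with t ht ht1
    congr 1
    rcases lt_or_ge t 1 with hlt | hge
    · rw [indicator_of_mem (show t ∈ Ioc (0 : ℝ) 1 from ⟨ht, hlt.le⟩), cutInv_of_lt ht hlt,
        Complex.cpow_neg_one]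
    · rw [cutInv_of_ge hge, indicator_of_notMem]
      exact fun h => ht1 (le_antisymm h.2 hge)
  refine ⟨(integrable_congr hae).1 h.1, ?_⟩
  rw [sub_eq_add_neg, ← h.2]
  exact (integral_congr_ae hae).symm

/-- `∫ (1_{t<1} - 1_{t<V}) dt/t = -log V`. -/
theorem integral_cutInv_sub {V : ℝ} (hV : 0 < V) :
    IntegrableOn (fun t => cutInv t - (V⁻¹ : ℝ) * cutInv (V⁻¹ * t)) (Ioi 0) ∧
    ∫ t in Ioi 0, (cutInv t - (V⁻¹ : ℝ) * cutInv (V⁻¹ * t)) = -(Real.log V : ℂ) := by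
  have hsc : ∀ t, 0 < t → ((V⁻¹ : ℝ) : ℂ) * cutInv (V⁻¹ * t) = if t < V then (t : ℂ)⁻¹ else 0 := by
    intro t ht
    have hVt : 0 < V⁻¹ * t := by positivity
    have hlt : V⁻¹ * t < 1 ↔ t < V := by rw [inv_mul_lt_iff₀ hV, mul_one]
    split_ifs with h
    · rw [cutInv_of_lt hVt (hlt.2 h)]
      push_cast
      have : (V : ℂ) ≠ 0 := by exact_mod_cast hV.ne'
      field_simp
    · rw [cutInv_of_ge (not_lt.1 fun h' => h (hlt.1 h')), mul_zero]
  have hc1 : ∀ t, 0 < t → cutInv t = if t < 1 then (t : ℂ)⁻¹ else 0 := by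
    intro t ht
    split_ifs with h
    · exact cutInv_of_lt ht h
    · exact cutInv_of_ge (not_lt.1 h)
  have hint : ∀ a b : ℝ, 0 < a → a ≤ b → IntegrableOn (fun t : ℝ => ((t⁻¹ : ℝ) : ℂ)) (Ico a b) ∧
      ∫ t in Ico a b, ((t⁻¹ : ℝ) : ℂ) = (Real.log (b / a) : ℂ) := by
    intro a b ha hab
    constructor
    · refine IntegrableOn.mono_set ?_ Ico_subset_Icc_self
      refine ContinuousOn.integrableOn_Icc (Complex.continuous_ofReal.comp_continuousOn ?_)
      exact continuousOn_inv₀.mono fun t ht => (ha.trans_le ht.1).ne'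
    · rw [integral_complex_ofReal, integral_Ico_eq_integral_Ioc,
        ← intervalIntegral.integral_of_le hab, integral_inv_of_pos ha (ha.trans_le hab)]
  rcases le_total V 1 with h | h
  · have he : EqOn (fun t => cutInv t - (V⁻¹ : ℝ) * cutInv (V⁻¹ * t))
        ((Ico V 1).indicator fun t : ℝ => ((t⁻¹ : ℝ) : ℂ)) (Ioi 0) := by
      intro t ht
      simp only [hsc t ht, hc1 t ht, indicator, mem_Ico]
      split_ifs <;> first | (push_cast; ring1) | (exfalso; grind)
    have hs : Ioi 0 ∩ Ico V 1 = Ico V 1 := inter_eq_right.2 fun t ht => hV.trans_le ht.1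
    obtain ⟨i1, i2⟩ := hint V 1 hV h
    rw [integrableOn_congr_fun he measurableSet_Ioi, setIntegral_congr_fun measurableSet_Ioi he,
      setIntegral_indicator measurableSet_Ico, hs, i2]
    refine ⟨((integrable_indicator_iff measurableSet_Ico).2 i1).integrableOn, ?_⟩
    rw [one_div, Real.log_inv]; push_cast; rfl
  · have he : EqOn (fun t => cutInv t - (V⁻¹ : ℝ) * cutInv (V⁻¹ * t))
        ((Ico 1 V).indicator fun t : ℝ => -((t⁻¹ : ℝ) : ℂ)) (Ioi 0) := by
      intro t ht
      simp only [hsc t ht, hc1 t ht, indicator, mem_Ico]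
      split_ifs <;> first | (push_cast; ring1) | (exfalso; grind)
    have hs : Ioi 0 ∩ Ico 1 V = Ico 1 V := inter_eq_right.2 fun t ht => one_pos.trans_le ht.1
    obtain ⟨i1, i2⟩ := hint 1 V one_pos h
    rw [integrableOn_congr_fun he measurableSet_Ioi, setIntegral_congr_fun measurableSet_Ioi he,
      setIntegral_indicator measurableSet_Ico, hs, integral_neg, i2, div_one]
    exact ⟨((integrable_indicator_iff measurableSet_Ico).2 i1.neg).integrableOn, rfl⟩

/-- Rescaling the argument of a cut-off integral produces a logarithm. -/
theorem integral_scale_sub_cutInv {f : ℝ → ℂ} {V : ℝ} (hV : 0 < V)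
    (hf : IntegrableOn (fun t => f t - cutInv t) (Ioi 0)) :
    IntegrableOn (fun t => V * f (V * t) - cutInv t) (Ioi 0) ∧
    ∫ t in Ioi 0, (V * f (V * t) - cutInv t) =
      (∫ t in Ioi 0, (f t - cutInv t)) - (Real.log V : ℂ) := by
  obtain ⟨i1, i2⟩ := integral_cutInv_sub hV
  have hsum : IntegrableOn (fun t => f t - (V⁻¹ : ℝ) * cutInv (V⁻¹ * t)) (Ioi 0) :=
    (hf.add i1).congr_fun (fun t _ => by simp) measurableSet_Ioi
  have hval : ∫ t in Ioi 0, (f t - (V⁻¹ : ℝ) * cutInv (V⁻¹ * t)) =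
      (∫ t in Ioi 0, (f t - cutInv t)) - (Real.log V : ℂ) := by
    rw [sub_eq_add_neg, ← i2, ← integral_add hf i1]
    exact setIntegral_congr_fun measurableSet_Ioi (fun t _ => by simp)
  have hVc : (V : ℂ) ≠ 0 := by exact_mod_cast hV.ne'
  have he : (fun t => V * f (V * t) - cutInv t) = fun t => (V : ℂ) *
      (fun u => f u - (V⁻¹ : ℝ) * cutInv (V⁻¹ * u)) (V * t) := by
    ext t
    simp only
    rw [inv_mul_cancel_left₀ hV.ne', mul_sub, ← mul_assoc]
    push_cast
    rw [mul_inv_cancel₀ hVc, one_mul]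
  have h0 : V * 0 = 0 := mul_zero V
  rw [he, ← hval]
  constructor
  · refine Integrable.const_mul ?_ _
    have := (integrableOn_Ioi_comp_mul_left_iff
      (fun u => f u - (V⁻¹ : ℝ) * cutInv (V⁻¹ * u)) 0 hV).2 (by rw [h0]; exact hsum)
    exact this
  · rw [integral_const_mul, integral_comp_mul_left_Ioi
      (fun u => f u - (V⁻¹ : ℝ) * cutInv (V⁻¹ * u)) 0 hV, h0, Complex.real_smul, ← mul_assoc]
    push_cast
    rw [mul_inv_cancel₀ hVc, one_mul]

end OneLoop

end

/-! ### The one-dimensional theta function and the Bessel-type double sum. -/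

noncomputable section

namespace OneLoop

open UpperHalfPlane ModularGroup Set HurwitzZeta Asymptotics
open scoped MatrixGroups

/-- Nonzero integers. -/
abbrev NonzeroInt : Type := {n : ℤ // n ≠ 0}

theorem hasSum_ne_iff {β E : Type*} [NormedAddCommGroup E] {f : β → E} {b : β} {a : E} :
    HasSum (fun r : {r // r ≠ b} => f r) a ↔ HasSum f (f b + a) := by
  classical
  have h0 : HasSum (fun r : {r // r ≠ b} => f r) a ↔ HasSum (({b}ᶜ : Set β).indicator f) a :=
    hasSum_subtype_iff_indicator (s := ({b}ᶜ : Set β))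
  have h1 : HasSum (({b} : Set β).indicator f) (f b) := by
    have := hasSum_single (f := ({b} : Set β).indicator f) b
      (fun x (hx : x ≠ b) => indicator_of_notMem (by simpa using hx) f)
    simpa using this
  rw [h0]
  constructor
  · intro h
    refine (h1.add h).congr_fun fun x => ?_
    by_cases hx : x = b
    · subst hx; simp
    · simp [hx]
  · intro h
    have := h.sub h1
    rw [add_sub_cancel_left] at this
    refine this.congr_fun fun x => ?_
    by_cases hx : x = b
    · subst hx; simp
    · simp [hx]

theorem hasSum_one_div_sq_nonzeroInt :
    HasSum (fun n : NonzeroInt => 1 / (n.1 : ℝ) ^ 2) (Real.pi ^ 2 / 3) := by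
  have h : HasSum (fun n : ℤ => 1 / (n : ℝ) ^ 2) (Real.pi ^ 2 / 3) := by
    have := HasSum.of_nat_of_neg (f := fun n : ℤ => 1 / (n : ℝ) ^ 2) (g := Real.pi ^ 2 / 6)
      (g' := Real.pi ^ 2 / 6) (by simpa using hasSum_zeta_two) (by simpa using hasSum_zeta_two)
    convert! this using 1
    simp; ring
  refine (hasSum_ne_iff (f := fun n : ℤ => 1 / (n : ℝ) ^ 2)).2 ?_
  simpa using h

theorem isBigO_evenKernel_sub_one :
    ∀ a : ℝ, (fun t : ℝ => evenKernel 0 t - 1) =O[atTop] fun t : ℝ => t ^ a := by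
  intro a
  obtain ⟨p, hp, h⟩ := isBigO_atTop_evenKernel_sub 0
  simp only [if_true] at h
  exact h.trans (isLittleO_exp_neg_mul_rpow_atTop hp a).isBigO

theorem evenKernel_zero_eq {t : ℝ} (ht : 0 < t) :
    evenKernel 0 t = t ^ (-(1 / 2) : ℝ) * evenKernel 0 t⁻¹ := by
  rw [evenKernel_functional_equation, ← evenKernel_eq_cosKernel_of_zero, Real.rpow_neg ht.le]
  simp

theorem isBigO_evenKernel_inv_sub_one (a : ℝ) :
    (fun t : ℝ => evenKernel 0 t⁻¹ - 1) =O[𝓝[>] 0] fun t : ℝ => t ^ a := by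
  refine ((isBigO_evenKernel_sub_one (-a)).comp_tendsto tendsto_inv_nhdsGT_zero).congr' .rfl ?_
  filter_upwards [self_mem_nhdsWithin] with t ht
  have ht : 0 < t := ht
  simp only [Function.comp]
  rw [Real.inv_rpow ht.le, Real.rpow_neg ht.le, inv_inv]

theorem isBigO_one_rpow_nhdsGT_zero {a : ℝ} (ha : a ≤ 0) :
    (fun _ : ℝ => (1 : ℝ)) =O[𝓝[>] 0] fun t : ℝ => t ^ a := by
  refine IsBigO.of_bound 1 ?_
  filter_upwards [Ioo_mem_nhdsGT (one_pos : (0 : ℝ) < 1)] with t ht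
  rw [norm_one, one_mul, Real.norm_of_nonneg (Real.rpow_nonneg ht.1.le a)]
  exact Real.one_le_rpow_of_pos_of_le_one_of_nonpos ht.1 ht.2.le ha

theorem isTame_evenKernel_sub_one : IsTame fun t => ((evenKernel 0 t - 1 : ℝ) : ℂ) where
  locallyIntegrableOn := (Complex.continuous_ofReal.comp_continuousOn
    ((continuousOn_evenKernel 0).sub continuousOn_const)).locallyIntegrableOn measurableSet_Ioi
  isBigO_atTop := Complex.isBigO_ofReal_left.2 (isBigO_evenKernel_sub_one _)
  isBigO_zero := by
    refine Complex.isBigO_ofReal_left.2 ?_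
    have h1 : (fun t : ℝ => evenKernel 0 t⁻¹) =O[𝓝[>] 0] fun _ : ℝ => (1 : ℝ) := by
      have h2 : (fun t : ℝ => evenKernel 0 t⁻¹ - 1) =O[𝓝[>] 0] fun _ : ℝ => (1 : ℝ) := by
        simpa using isBigO_evenKernel_inv_sub_one 0
      simpa using h2.add (isBigO_refl (fun _ : ℝ => (1 : ℝ)) _)
    have h3 : (fun t : ℝ => evenKernel 0 t) =O[𝓝[>] 0] fun t : ℝ => t ^ (-(1 / 2) : ℝ) := by
      refine (((isBigO_refl (fun t : ℝ => t ^ (-(1 / 2) : ℝ)) _).mul h1).congr' ?_ ?_)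
      · filter_upwards [self_mem_nhdsWithin] with t ht using (evenKernel_zero_eq ht).symm
      · exact Eventually.of_forall fun t => mul_one _
    exact h3.sub (isBigO_one_rpow_nhdsGT_zero (by norm_num))

/-- Termwise, `∫ exp(-π n² t) dt = 1/(π n²)`; this is the Mellin transform at `s = 1`, and `∑ 1/n² =
π²/3` over nonzero `n`. -/
theorem integral_evenKernel_sub_one :
    ∫ t in Ioi 0, ((evenKernel 0 t - 1 : ℝ) : ℂ) = (Real.pi / 3 : ℝ) := by
  have hs := hasSum_mellin_pi_mul (ι := NonzeroInt) (a := fun _ => 1) (q := fun n => (n.1 : ℝ) ^ 2)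
    (F := fun t => ((evenKernel 0 t - 1 : ℝ) : ℂ)) (s := 1)
    (fun n => Or.inr (by have := n.2; positivity)) (by simp) (by
      intro t ht
      have h1 := hasSum_int_evenKernel 0 ht
      have h2 := (hasSum_ne_iff (f := fun n : ℤ => Real.exp (-Real.pi * (n + 0) ^ 2 * t)) (b := 0)
        (a := evenKernel 0 t - 1)).2 (by simpa using h1)
      simpa using Complex.hasSum_ofReal.2 h2)
    (by simpa using hasSum_one_div_sq_nonzeroInt.summable)
  have h3 := (Complex.hasSum_ofReal.2 hasSum_one_div_sq_nonzeroInt).mul_left ((Real.pi : ℂ)⁻¹)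
  have h4 : HasSum (fun n : NonzeroInt => (Real.pi : ℂ)⁻¹ * ((1 / (n.1 : ℝ) ^ 2 : ℝ) : ℂ))
      (mellin (fun t => ((evenKernel 0 t - 1 : ℝ) : ℂ)) 1) := by
    refine hs.congr_fun fun n => ?_
    simp [Complex.cpow_neg_one, div_eq_mul_inv]
  have h5 := h4.unique h3
  rw [mellin] at h5
  simp only [sub_self, Complex.cpow_zero, one_smul] at h5
  rw [h5]
  push_cast
  have : (Real.pi : ℂ) ≠ 0 := by exact_mod_cast Real.pi_ne_zero
  field_simp

/-- `t^{-1/2} (θ(t) - 1)`, where `θ(t) = ∑ exp(-π n² t)`. -/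
def thetaDual (t : ℝ) : ℂ := ((t ^ (-(1 / 2) : ℝ) * (evenKernel 0 t - 1) : ℝ) : ℂ)

theorem continuousOn_thetaDual : ContinuousOn thetaDual (Ioi 0) := by
  refine Complex.continuous_ofReal.comp_continuousOn (ContinuousOn.mul ?_
    ((continuousOn_evenKernel 0).sub continuousOn_const))
  exact continuousOn_id.rpow_const fun t (ht : 0 < t) => Or.inl ht.ne'

/-- By theta inversion `t^{-1/2} (θ(t) - 1) = t⁻¹ θ(1/t) - t^{-1/2}`. Near zero the cut-off removes
`1/t`, and up to rapidly decreasing terms only `-t^{-1/2}` survives, the order that `IsTame` allows.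
-/
theorem isTame_thetaDual_sub : IsTame fun t => thetaDual t - cutInv t where
  locallyIntegrableOn :=
    (continuousOn_thetaDual.locallyIntegrableOn measurableSet_Ioi).sub locallyIntegrableOn_cutInv
  isBigO_atTop := by
    have h : thetaDual =O[atTop] fun t : ℝ => t ^ (-2 : ℝ) := by
      refine Complex.isBigO_ofReal_left.2 ?_
      refine ((isBigO_refl (fun t : ℝ => t ^ (-(1 / 2) : ℝ)) _).mul
        (isBigO_evenKernel_sub_one (-(3 / 2)))).congr' .rfl ?_
      filter_upwards [eventually_gt_atTop 0] with t ht
      rw [← Real.rpow_add ht]; norm_num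
    refine h.congr' ?_ .rfl
    filter_upwards [eventually_ge_atTop 1] with t ht
    rw [cutInv_of_ge ht, sub_zero]
  isBigO_zero := by
    have h1 : (fun t : ℝ => t ^ (-1 : ℝ) * (evenKernel 0 t⁻¹ - 1)) =O[𝓝[>] 0]
        fun t : ℝ => t ^ (-(1 / 2) : ℝ) := by
      refine ((isBigO_refl (fun t : ℝ => t ^ (-1 : ℝ)) _).mul
        (isBigO_evenKernel_inv_sub_one (1 / 2))).congr' .rfl ?_
      filter_upwards [self_mem_nhdsWithin] with t ht
      rw [← Real.rpow_add ht]; norm_num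
    refine (Complex.isBigO_ofReal_left.2
      (h1.sub (isBigO_refl (fun t : ℝ => t ^ (-(1 / 2) : ℝ)) _))).congr' ?_ .rfl
    filter_upwards [Ioo_mem_nhdsGT (one_pos : (0 : ℝ) < 1)] with t ht
    rw [cutInv_of_lt ht.1 ht.2, thetaDual, evenKernel_zero_eq ht.1, ← Complex.ofReal_inv,
      ← Complex.ofReal_sub]
    congr 1
    have : t ^ (-(1 / 2) : ℝ) * t ^ (-(1 / 2) : ℝ) = t ^ (-1 : ℝ) := by
      rw [← Real.rpow_add ht.1]; norm_num
    rw [mul_sub, mul_sub, ← mul_assoc, this, Real.rpow_neg_one]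
    ring

/-- The Bessel-type term `√(y/t) exp(-π y (t n² + k²/t))`. -/
def bess (y : ℝ) (n k : ℤ) (t : ℝ) : ℝ :=
  √(y / t) * Real.exp (-Real.pi * y * (t * n ^ 2 + k ^ 2 / t))

/-- With `u = y / t` this lets the prefactor of `bess` be absorbed by part of the exponential decay.
-/
theorem sqrt_le_exp {u : ℝ} (hu : 0 ≤ u) : √u ≤ Real.exp (Real.pi * (u / 2)) := by
  rw [Real.sqrt_le_left (Real.exp_pos _).le, ← Real.exp_nat_mul]
  have h := Real.add_one_le_exp u
  have : Real.exp u ≤ Real.exp ((2 : ℕ) * (Real.pi * (u / 2))) := by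
    refine Real.exp_le_exp.2 ?_
    push_cast
    nlinarith [Real.pi_gt_three]
  linarith

/-- Summable majorant of the Bessel-type terms. -/
def bessBound (y : ℝ) (p : NonzeroInt × NonzeroInt) : ℝ :=
  Real.exp (-(Real.pi * y / 2) * |(p.1.1 : ℝ)|) * Real.exp (-(Real.pi * y / 2) * |(p.2.1 : ℝ)|)

theorem summable_exp_neg_abs_int {a : ℝ} (ha : 0 < a) :
    Summable fun n : ℤ => Real.exp (-a * |(n : ℝ)|) := by
  rw [summable_int_iff_summable_nat_and_neg]
  have : Summable fun n : ℕ => Real.exp (-a * (n : ℝ)) := by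
    simpa [mul_comm] using Real.summable_exp_nat_mul_iff.2 (neg_neg_of_pos ha)
  constructor <;> simpa using this

theorem summable_bessBound {y : ℝ} (hy : 0 < y) : Summable (bessBound y) := by
  have ha : 0 < Real.pi * y / 2 := by positivity
  have h : Summable fun n : NonzeroInt => Real.exp (-(Real.pi * y / 2) * |(n.1 : ℝ)|) :=
    (summable_exp_neg_abs_int ha).comp_injective Subtype.val_injective
  exact h.mul_of_nonneg h (fun _ => (Real.exp_pos _).le) (fun _ => (Real.exp_pos _).le)

/-- With `N = |n|`, `K = |k|`, both at least 1, the quantity `t N² + K²/t` dominates `t + 1/t` as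
well as `2 N K ≥ N + K`, hence their average. The `1/t` pays for the square root, the `t` gives
decay in `t`, and `N + K` gives summability. -/
theorem bess_le {y t : ℝ} (hy : 0 < y) (ht : 0 < t) (p : NonzeroInt × NonzeroInt) :
    bess y p.1.1 p.2.1 t ≤ Real.exp (-(Real.pi * y / 2) * t) * bessBound y p := by
  obtain ⟨⟨n, hn⟩, ⟨k, hk⟩⟩ := p
  have hN : (1 : ℝ) ≤ |(n : ℝ)| := by exact_mod_cast Int.one_le_abs hn
  have hK : (1 : ℝ) ≤ |(k : ℝ)| := by exact_mod_cast Int.one_le_abs hk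
  have h1 := sqrt_le_exp (u := y / t) (by positivity)
  refine (mul_le_mul_of_nonneg_right h1 (Real.exp_pos _).le).trans ?_
  rw [bessBound, ← Real.exp_add, ← Real.exp_add, ← Real.exp_add]
  refine Real.exp_le_exp.2 ?_
  simp only
  rw [← sq_abs (n : ℝ), ← sq_abs (k : ℝ)]
  set N := |(n : ℝ)|
  set K := |(k : ℝ)|
  have key : 1 / (2 * t) + t / 2 + (N + K) / 2 ≤ t * N ^ 2 + K ^ 2 / t := by
    have e1 : t * N ^ 2 + K ^ 2 / t - 2 * (N * K) = (t * N - K) ^ 2 / t := by field_simp; ring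
    have e2 : 0 ≤ (t * N - K) ^ 2 / t := by positivity
    have e3 : t ≤ t * N ^ 2 := le_mul_of_one_le_right ht.le (by nlinarith)
    have e4 : 1 / t ≤ K ^ 2 / t := by gcongr; nlinarith
    have e5 : 1 / (2 * t) = 1 / t / 2 := by field_simp
    nlinarith
  have hpy : 0 < Real.pi * y := by positivity
  have := mul_le_mul_of_nonneg_left key hpy.le
  have e6 : Real.pi * y * (1 / (2 * t)) = Real.pi * (y / t / 2) := by field_simp
  nlinarith

theorem bess_nonneg (y : ℝ) (n k : ℤ) (t : ℝ) : 0 ≤ bess y n k t :=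
  mul_nonneg (Real.sqrt_nonneg _) (Real.exp_pos _).le

theorem continuousOn_bess (y : ℝ) (n k : ℤ) : ContinuousOn (bess y n k) (Ioi 0) := by
  have h0 : ∀ t ∈ Ioi (0 : ℝ), t ≠ 0 := fun t (ht : 0 < t) => ht.ne'
  unfold bess
  refine ContinuousOn.mul (Real.continuous_sqrt.comp_continuousOn
    (continuousOn_const.div continuousOn_id h0)) (Real.continuous_exp.comp_continuousOn ?_)
  exact continuousOn_const.mul ((continuousOn_id.mul continuousOn_const).add
    (continuousOn_const.div continuousOn_id h0))

theorem integrableOn_exp_neg_mul {a : ℝ} (ha : 0 < a) :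
    IntegrableOn (fun t : ℝ => Real.exp (-a * t)) (Ioi 0) :=
  exp_neg_integrableOn_Ioi 0 ha

/-- The phase `exp(2π i n k x)`. -/
def phase (x : ℝ) (n k : ℤ) : ℂ := Complex.exp (2 * Real.pi * Complex.I * (n * x : ℝ) * k)

theorem norm_phase (x : ℝ) (n k : ℤ) : ‖phase x n k‖ = 1 := by
  have : phase x n k = Complex.exp ((2 * Real.pi * (n * x) * k : ℝ) * Complex.I) := by
    rw [phase]; congr 1; push_cast; ring
  rw [this, Complex.norm_exp_ofReal_mul_I]

/-- The double sum of Bessel-type terms. -/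
def bessSum (x y t : ℝ) : ℂ :=
  ∑' p : NonzeroInt × NonzeroInt, phase x p.1 p.2 * (bess y p.1 p.2 t : ℂ)

theorem norm_phase_mul_bess_le {x y t : ℝ} (hy : 0 < y) (ht : 0 < t)
    (p : NonzeroInt × NonzeroInt) : ‖phase x p.1 p.2 * (bess y p.1 p.2 t : ℂ)‖ ≤
      Real.exp (-(Real.pi * y / 2) * t) * bessBound y p := by
  rw [norm_mul, norm_phase, one_mul, Complex.norm_real, Real.norm_of_nonneg (bess_nonneg _ _ _ _)]
  exact bess_le hy ht p

theorem hasSum_bessSum {x y t : ℝ} (hy : 0 < y) (ht : 0 < t) :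
    HasSum (fun p : NonzeroInt × NonzeroInt => phase x p.1 p.2 * (bess y p.1 p.2 t : ℂ))
      (bessSum x y t) :=
  (Summable.of_norm_bounded ((summable_bessBound hy).mul_left _)
    (norm_phase_mul_bess_le hy ht)).hasSum

theorem isTame_bessSum (x : ℝ) {y : ℝ} (hy : 0 < y) : IsTame (bessSum x y) := by
  have ha : 0 < Real.pi * y / 2 := by positivity
  have hbound : ∀ t : ℝ, 0 < t →
      ‖bessSum x y t‖ ≤ (∑' p, bessBound y p) * ‖Real.exp (-(Real.pi * y / 2) * t)‖ := by
    intro t ht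
    rw [Real.norm_of_nonneg (Real.exp_pos _).le, mul_comm]
    exact tsum_of_norm_bounded ((summable_bessBound hy).hasSum.mul_left _)
      (norm_phase_mul_bess_le hy ht)
  have hO : ∀ l : Filter ℝ, (∀ᶠ t in l, 0 < t) →
      bessSum x y =O[l] fun t => Real.exp (-(Real.pi * y / 2) * t) :=
    fun l hl => IsBigO.of_bound _ (hl.mono hbound)
  refine ⟨?_, ?_, ?_⟩
  · refine ContinuousOn.locallyIntegrableOn ?_ measurableSet_Ioi
    refine continuousOn_tsum (u := bessBound y) (fun p => ?_) (summable_bessBound hy) ?_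
    · exact continuousOn_const.mul (Complex.continuous_ofReal.comp_continuousOn
        (continuousOn_bess _ _ _))
    · intro p t ht
      refine (norm_phase_mul_bess_le hy ht p).trans ?_
      have hb : 0 ≤ bessBound y p := by unfold bessBound; positivity
      have : Real.exp (-(Real.pi * y / 2) * t) ≤ 1 :=
        Real.exp_le_one_iff.2 (by have : 0 < Real.pi * y / 2 * t := mul_pos ha ht; linarith)
      nlinarith
  · exact (hO _ (eventually_gt_atTop 0)).trans (isLittleO_exp_neg_mul_rpow_atTop ha _).isBigO
  · refine (hO _ self_mem_nhdsWithin).trans (IsBigO.trans ?_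
      (isBigO_one_rpow_nhdsGT_zero (by norm_num)))
    refine IsBigO.of_bound 1 ?_
    filter_upwards [self_mem_nhdsWithin] with t ht
    rw [Real.norm_of_nonneg (Real.exp_pos _).le, norm_one, mul_one]
    exact Real.exp_le_one_iff.2 (by have : 0 < Real.pi * y / 2 * t := mul_pos ha ht; linarith)

theorem integrableOn_bess {y : ℝ} (hy : 0 < y) (p : NonzeroInt × NonzeroInt) :
    IntegrableOn (bess y p.1 p.2) (Ioi 0) := by
  have ha : 0 < Real.pi * y / 2 := by positivity
  refine Integrable.mono' ((integrableOn_exp_neg_mul ha).mul_const (bessBound y p))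
    ((continuousOn_bess _ _ _).aestronglyMeasurable measurableSet_Ioi) ?_
  filter_upwards [ae_restrict_mem measurableSet_Ioi] with t ht
  rw [Real.norm_of_nonneg (bess_nonneg _ _ _ _)]
  exact bess_le hy ht p

theorem summable_integral_bess {y : ℝ} (hy : 0 < y) :
    Summable fun p : NonzeroInt × NonzeroInt => ∫ t in Ioi 0, bess y p.1 p.2 t := by
  have ha : 0 < Real.pi * y / 2 := by positivity
  refine Summable.of_nonneg_of_le (fun p => integral_nonneg fun t => bess_nonneg _ _ _ _)
    (fun p => ?_) ((summable_bessBound hy).mul_left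
      (∫ t in Ioi 0, Real.exp (-(Real.pi * y / 2) * t)))
  rw [← integral_mul_const]
  exact setIntegral_mono_on (integrableOn_bess hy p)
    ((integrableOn_exp_neg_mul ha).mul_const _) measurableSet_Ioi fun t ht => bess_le hy ht p

theorem hasSum_integral_bessSum (x : ℝ) {y : ℝ} (hy : 0 < y) :
    HasSum (fun p : NonzeroInt × NonzeroInt => phase x p.1 p.2 * (∫ t in Ioi 0, bess y p.1 p.2 t : ℝ))
      (∫ t in Ioi 0, bessSum x y t) := by
  have h := hasSum_integral_of_summable_integral_norm (μ := volume.restrict (Ioi 0))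
    (F := fun (p : NonzeroInt × NonzeroInt) t => phase x p.1 p.2 * (bess y p.1 p.2 t : ℂ))
    (fun p => ((integrableOn_bess hy p).ofReal).const_mul _) (by
      simp only [norm_mul, norm_phase, one_mul, Complex.norm_real,
        Real.norm_of_nonneg (bess_nonneg _ _ _ _)]
      exact summable_integral_bess hy)
  refine h.congr_fun fun p => ?_
  rw [integral_const_mul, integral_complex_ofReal]

end OneLoop

end

/-! ### The theta series of a unimodular binary form, its Chowla–Selberg expansion, and the Epstein
zeta function at `s = 1`. -/

noncomputable section

namespace OneLoop

open UpperHalfPlane ModularGroup Set HurwitzZeta Asymptotics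
open scoped MatrixGroups

/-- The unimodular positive definite form `((m + n x)² + n² y²) / y`. -/
def qform (x y : ℝ) (r : ℤ × ℤ) : ℝ := (((r.1 : ℝ) + r.2 * x) ^ 2 + (r.2 : ℝ) ^ 2 * y ^ 2) / y

theorem exists_binaryForm_lower_bound (x : ℝ) {y : ℝ} (hy : 0 < y) :
    ∃ c > 0, ∀ m n : ℝ, c * (m ^ 2 + n ^ 2) ≤ ((m + n * x) ^ 2 + n ^ 2 * y ^ 2) / y := by
  -- The constant comes from `m² ≤ 2 (m + n x)² + 2 n² x²`, so that `m² + n² ≤ 2 (m + n x)² + (2 x²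
  -- + 1) n²`.
  refine ⟨(2 + (2 * x ^ 2 + 1) / y ^ 2)⁻¹ / y, by positivity, fun m n => ?_⟩
  rw [div_mul_eq_mul_div]
  gcongr
  rw [inv_mul_le_iff₀ (by positivity)]
  have h1 : (2 * x ^ 2 + 1) / y ^ 2 * (n ^ 2 * y ^ 2) = (2 * x ^ 2 + 1) * n ^ 2 := by
    field_simp
  have h2 : 0 ≤ (2 * x ^ 2 + 1) / y ^ 2 * (m + n * x) ^ 2 := by positivity
  nlinarith [sq_nonneg (m + 2 * n * x), mul_nonneg (sq_nonneg n) (sq_nonneg y)]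

theorem exists_qform_lower_bound (x : ℝ) {y : ℝ} (hy : 0 < y) :
    ∃ c > 0, ∀ r : ℤ × ℤ, c * ((r.1 : ℝ) ^ 2 + (r.2 : ℝ) ^ 2) ≤ qform x y r :=
  let ⟨c, hc, h⟩ := exists_binaryForm_lower_bound x hy
  ⟨c, hc, fun r => h r.1 r.2⟩

theorem qform_pos (x : ℝ) {y : ℝ} (hy : 0 < y) (r : NonzeroPair) : 0 < qform x y r.1 := by
  obtain ⟨c, hc, h⟩ := exists_qform_lower_bound x hy
  refine lt_of_lt_of_le (mul_pos hc ?_) (h r.1)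
  obtain ⟨⟨m, n⟩, hr⟩ := r
  by_cases hm : m = 0
  · have hn : n ≠ 0 := fun hn => hr (by simp [hm, hn])
    positivity
  · positivity

theorem summable_qform_rpow (x : ℝ) {y σ : ℝ} (hy : 0 < y) (hσ : 1 < σ) :
    Summable fun r : NonzeroPair => 1 / qform x y r.1 ^ σ := by
  obtain ⟨c, hc, h⟩ := exists_qform_lower_bound x hy
  have hs := (EisensteinSeries.summable_one_div_norm_rpow (k := 2 * σ) (by linarith)).mul_left
    (1 / c ^ σ)
  have hinj : Function.Injective fun r : NonzeroPair => (![r.1.1, r.1.2] : Fin 2 → ℤ) := by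
    intro r s hrs
    apply Subtype.ext
    exact Prod.ext (congrFun hrs 0) (congrFun hrs 1)
  refine Summable.of_nonneg_of_le (fun r => ?_) (fun r => ?_) (hs.comp_injective hinj)
  · have := qform_pos x hy r
    positivity
  · have hv : 0 < ‖(![r.1.1, r.1.2] : Fin 2 → ℤ)‖ := by
      rw [norm_pos_iff]
      intro h0
      exact r.2 (Prod.ext (congrFun h0 0) (congrFun h0 1))
    have hle : c * ‖(![r.1.1, r.1.2] : Fin 2 → ℤ)‖ ^ 2 ≤ qform x y r.1 := by
      refine le_trans ?_ (h r.1)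
      gcongr
      rw [EisensteinSeries.norm_eq_max_natAbs]
      simp only [Matrix.cons_val_zero, Matrix.cons_val_one, Nat.cast_max, Nat.cast_natAbs,
        Int.cast_abs]
      rcases max_choice |(r.1.1 : ℝ)| |(r.1.2 : ℝ)| with e | e <;> rw [e, sq_abs] <;>
        nlinarith [sq_nonneg (r.1.1 : ℝ), sq_nonneg (r.1.2 : ℝ)]
    simp only [Function.comp]
    have e1 : ‖(![r.1.1, r.1.2] : Fin 2 → ℤ)‖ ^ (-(2 * σ)) =
        1 / (‖(![r.1.1, r.1.2] : Fin 2 → ℤ)‖ ^ 2) ^ σ := by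
      rw [Real.rpow_neg hv.le, Real.rpow_mul hv.le, one_div]
      norm_cast
    rw [e1, div_mul_div_comm, one_mul, ← Real.mul_rpow hc.le (by positivity)]
    exact one_div_le_one_div_of_le (by positivity)
      (Real.rpow_le_rpow (by positivity) hle (by linarith))

theorem evenKernel_eq_cosKernel {a t : ℝ} (ht : 0 < t) (y : ℝ) :
    evenKernel a (t / y) = √(y / t) * cosKernel a (y / t) := by
  rw [evenKernel_functional_equation, one_div_div, Real.sqrt_eq_rpow]
  rcases le_or_gt y 0 with hy | hy
  · rw [cosKernel_undef _ (div_nonpos_of_nonpos_of_nonneg hy ht.le)]; simp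
  · rw [← inv_div y t, Real.inv_rpow (by positivity), one_div, inv_inv]

theorem sqrt_div_mul_evenKernel_sub_one {y t : ℝ} (hy : 0 < y) (ht : 0 < t) :
    ((√(y / t) * (evenKernel 0 (y * t) - 1) : ℝ) : ℂ) = y * thetaDual (y * t) := by
  rw [thetaDual, ← Complex.ofReal_mul, ← mul_assoc]
  congr 2
  rw [Real.mul_rpow hy.le ht.le, ← mul_assoc, Real.sqrt_div hy.le, Real.sqrt_eq_rpow,
    Real.sqrt_eq_rpow, Real.rpow_neg ht.le, div_eq_mul_inv]
  congr 1
  nth_rewrite 2 [← Real.rpow_one y]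
  rw [← Real.rpow_add hy]; norm_num

/-- Poisson resummation of one row of the theta series of `qform`. -/
theorem hasSum_phase_mul_bess (x : ℝ) {y t : ℝ} (hy : 0 < y) (ht : 0 < t) (n : ℤ) :
    HasSum (fun k : NonzeroInt => phase x n k * (bess y n k t : ℂ))
      (((Real.exp (-Real.pi * n ^ 2 * (y * t)) * evenKernel (n * x : ℝ) (t / y) -
        √(y / t) * Real.exp (-Real.pi * n ^ 2 * (y * t)) : ℝ)) : ℂ) := by
  have hyt : 0 < y / t := by positivity
  have h1 := hasSum_int_cosKernel (n * x) hyt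
  have h2 := (hasSum_ne_iff (b := 0) (f := fun k : ℤ => Complex.exp (2 * Real.pi * Complex.I *
    (n * x : ℝ) * k) * (Real.exp (-Real.pi * k ^ 2 * (y / t)) : ℂ))
    (a := (cosKernel (n * x : ℝ) (y / t) : ℂ) - 1)).2 (by simpa using h1)
  have h3 := h2.mul_left ((√(y / t) * Real.exp (-Real.pi * n ^ 2 * (y * t)) : ℝ) : ℂ)
  rw [evenKernel_eq_cosKernel ht y]
  convert! h3 using 1
  · ext k
    rw [phase, bess, mul_left_comm, ← Complex.ofReal_mul, mul_assoc (√(y / t)), ← Real.exp_add]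
    congr 4
    field_simp
    ring
  · push_cast; ring

theorem evenKernel_nonneg (a : ℝ) {t : ℝ} (ht : 0 < t) : 0 ≤ evenKernel a t :=
  (hasSum_int_evenKernel a ht).nonneg fun _ => (Real.exp_pos _).le

theorem hasSum_exp_sq_nonzeroInt {t : ℝ} (ht : 0 < t) :
    HasSum (fun n : NonzeroInt => Real.exp (-Real.pi * n ^ 2 * t)) (evenKernel 0 t - 1) := by
  refine (hasSum_ne_iff (f := fun n : ℤ => Real.exp (-Real.pi * n ^ 2 * t)) (b := 0)).2 ?_
  simpa using hasSum_int_evenKernel 0 ht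

/-- Poisson resummation of the theta series of `qform`. -/
theorem hasSum_exp_qform (x : ℝ) {y t : ℝ} (hy : 0 < y) (ht : 0 < t) :
    HasSum (fun r : NonzeroPair => (Real.exp (-Real.pi * qform x y r.1 * t) : ℂ))
      (((evenKernel 0 (y⁻¹ * t) - 1 : ℝ) : ℂ) + y * thetaDual (y * t) + bessSum x y t) := by
  have hyt : 0 < t / y := by positivity
  set R : ℤ → ℝ := fun n =>
    Real.exp (-Real.pi * n ^ 2 * (y * t)) * evenKernel (n * x : ℝ) (t / y) with hR
  set G : ℤ × ℤ → ℝ := fun p => Real.exp (-Real.pi * qform x y (p.2, p.1) * t) with hG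
  have hrow : ∀ n : ℤ, HasSum (fun m : ℤ => G (n, m)) (R n) := by
    intro n
    refine ((hasSum_int_evenKernel (n * x) hyt).mul_left _).congr_fun fun m => ?_
    simp only [hG, qform]
    rw [← Real.exp_add]
    congr 1
    field_simp
    ring
  -- For the rows `n ≠ 0`, the zero Fourier modes add up to `y * thetaDual (y * t)` and the nonzero
  -- modes to `bessSum`. The row `n = 0` is left as `θ(t / y)`.
  have hRnz : HasSum (fun n : NonzeroInt => ((R n : ℝ) : ℂ))
      (y * thetaDual (y * t) + bessSum x y t) := by
    have h1 := (hasSum_bessSum (x := x) hy ht).prod_fiberwise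
      fun n => hasSum_phase_mul_bess x hy ht n.1
    have h2 := Complex.hasSum_ofReal.2 ((hasSum_exp_sq_nonzeroInt (mul_pos hy ht)).mul_left (√(y / t)))
    rw [sqrt_div_mul_evenKernel_sub_one hy ht] at h2
    refine (h2.add h1).congr_fun fun n => ?_
    rw [← Complex.ofReal_add]
    congr 1
    simp only [hR]
    ring
  have hRc : HasSum (fun n : ℤ => ((R n : ℝ) : ℂ))
      (evenKernel 0 (t / y) + (y * thetaDual (y * t) + bessSum x y t)) := by
    have := (hasSum_ne_iff (f := fun n : ℤ => ((R n : ℝ) : ℂ)) (b := 0)).1 hRnz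
    simpa [hR] using this
  -- The terms are positive, so convergence of the row sums already gives summability of the double
  -- series.
  have hGs : Summable G := by
    refine (summable_prod_of_nonneg fun _ => (Real.exp_pos _).le).2
      ⟨fun n => (hrow n).summable, ?_⟩
    rw [show (fun n => ∑' m, G (n, m)) = R from funext fun n => (hrow n).tsum_eq]
    exact Complex.summable_ofReal.1 hRc.summable
  have hGc : HasSum (fun p : ℤ × ℤ => (G p : ℂ))
      (evenKernel 0 (t / y) + (y * thetaDual (y * t) + bessSum x y t)) := by
    have h1 : HasSum (fun p : ℤ × ℤ => (G p : ℂ)) ((∑' p, G p : ℝ) : ℂ) :=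
      Complex.hasSum_ofReal.2 hGs.hasSum
    have h2 := h1.prod_fiberwise fun n => Complex.hasSum_ofReal.2 (hrow n)
    rwa [← hRc.unique h2] at h1
  refine (hasSum_ne_iff (f := fun r : ℤ × ℤ => (Real.exp (-Real.pi * qform x y r * t) : ℂ))
    (b := 0)).2 ?_
  rw [← (Equiv.prodComm ℤ ℤ).hasSum_iff]
  have e0 : (Real.exp (-Real.pi * qform x y 0 * t) : ℂ) + (((evenKernel 0 (y⁻¹ * t) - 1 : ℝ) : ℂ) +
      y * thetaDual (y * t) + bessSum x y t) =
      evenKernel 0 (t / y) + (y * thetaDual (y * t) + bessSum x y t) := by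
    rw [inv_mul_eq_div, show qform x y 0 = 0 by simp [qform]]
    push_cast
    simp
    ring
  rw [e0]
  exact hGc

/-- The theta series `∑_{r ≠ 0} exp(-π t q(r))` of `qform`. -/
def thetaQ (x y t : ℝ) : ℂ := ∑' r : NonzeroPair, (Real.exp (-Real.pi * qform x y r.1 * t) : ℂ)

theorem thetaQ_eq (x : ℝ) {y t : ℝ} (hy : 0 < y) (ht : 0 < t) :
    thetaQ x y t = ((evenKernel 0 (y⁻¹ * t) - 1 : ℝ) : ℂ) + y * thetaDual (y * t) + bessSum x y t :=
  (hasSum_exp_qform x hy ht).tsum_eq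

/-- Rescaling moves the jump of the cut-off from `1` to `1/y`, but `y * cutInv (y * t)` and `cutInv
t` agree near both ends of the half-line, and the growth bounds only look there. -/
theorem isTame_scaled_thetaDual_sub {y : ℝ} (hy : 0 < y) :
    IsTame fun t => y * thetaDual (y * t) - cutInv t := by
  have h := (isTame_thetaDual_sub.comp_mul_left hy).const_mul (y : ℂ)
  have hyc : (y : ℂ) ≠ 0 := by exact_mod_cast hy.ne'
  refine h.congr_ends ?_ ?_ ?_
  · have := locallyIntegrableOn_comp_mul_left hy
      (continuousOn_thetaDual.locallyIntegrableOn measurableSet_Ioi)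
    exact (this.smul (y : ℂ)).sub locallyIntegrableOn_cutInv
  · filter_upwards [eventually_ge_atTop 1, eventually_ge_atTop y⁻¹] with t h1 h2
    have h3 : 1 ≤ y * t := by rwa [inv_le_iff_one_le_mul₀' hy] at h2
    rw [cutInv_of_ge h1, cutInv_of_ge h3, sub_zero, sub_zero]
  · filter_upwards [Ioo_mem_nhdsGT (one_pos : (0 : ℝ) < 1),
      Ioo_mem_nhdsGT (inv_pos.2 hy)] with t h1 h2
    have h3 : y * t < 1 := by have := h2.2; rwa [lt_inv_comm₀ h2.1 hy, ← one_div, lt_div_iff₀ h2.1] at this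
    rw [cutInv_of_lt h1.1 h1.2, cutInv_of_lt (mul_pos hy h1.1) h3, mul_sub]
    push_cast
    rw [mul_inv, mul_inv_cancel_left₀ hyc]

theorem IsTame.congr_Ioi {f g : ℝ → ℂ} (hf : IsTame f) (h : EqOn g f (Ioi 0)) : IsTame g := by
  refine hf.congr_ends ?_ ?_ ?_
  · have := hf.1
    rw [locallyIntegrableOn_iff isOpen_Ioi.isLocallyClosed] at this ⊢
    intro K hK hKc
    exact (integrableOn_congr_fun (h.mono hK) hKc.measurableSet).2 (this K hK hKc)
  · filter_upwards [eventually_gt_atTop 0] with t ht using h ht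
  · filter_upwards [self_mem_nhdsWithin] with t ht using h ht

theorem thetaQ_sub_cutInv_eqOn (x : ℝ) {y : ℝ} (hy : 0 < y) :
    EqOn (fun t => thetaQ x y t - cutInv t) (fun t => ((evenKernel 0 (y⁻¹ * t) - 1 : ℝ) : ℂ) +
      (y * thetaDual (y * t) - cutInv t) + bessSum x y t) (Ioi 0) := by
  intro t ht
  simp only [thetaQ_eq x hy ht]
  ring

theorem isTame_thetaQ_sub (x : ℝ) {y : ℝ} (hy : 0 < y) :
    IsTame fun t => thetaQ x y t - cutInv t :=
  (((isTame_evenKernel_sub_one.comp_mul_left (inv_pos.2 hy)).add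
    (isTame_scaled_thetaDual_sub hy)).add (isTame_bessSum x hy)).congr_Ioi
    (thetaQ_sub_cutInv_eqOn x hy)

/-- The regularized integral of the theta series of `qform`. -/
def regTheta (x y : ℝ) : ℂ := ∫ t in Ioi 0, (thetaQ x y t - cutInv t)

/-- The constant `∫ (t^{-1/2} (θ(t) - 1) - 1_{t<1}/t) dt`. -/
def thetaDualConst : ℂ := ∫ t in Ioi 0, (thetaDual t - cutInv t)

/-- Needed because the additive constant in the theorem is to be real. -/
theorem thetaDualConst_eq_ofReal : ∃ c : ℝ, thetaDualConst = c := by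
  refine ⟨∫ t in Ioi 0, (t ^ (-(1 / 2) : ℝ) * (evenKernel 0 t - 1) - cutIm t⁻¹), ?_⟩
  rw [← integral_complex_ofReal, thetaDualConst]
  refine setIntegral_congr_fun measurableSet_Ioi fun t _ => ?_
  simp [thetaDual, cutInv]

/-- Chowla–Selberg expansion of the regularized theta integral. -/
theorem regTheta_eq (x : ℝ) {y : ℝ} (hy : 0 < y) :
    regTheta x y = y * (Real.pi / 3 : ℝ) + (thetaDualConst - (Real.log y : ℂ)) +
      ∫ t in Ioi 0, bessSum x y t := by
  have h1 := (isTame_evenKernel_sub_one.comp_mul_left (inv_pos.2 hy)).integrableOn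
  have h2 := (isTame_scaled_thetaDual_sub hy).integrableOn
  have h3 := (isTame_bessSum x hy).integrableOn
  have e1 : ∫ t in Ioi 0, ((evenKernel 0 (y⁻¹ * t) - 1 : ℝ) : ℂ) = y * (Real.pi / 3 : ℝ) := by
    rw [integral_comp_mul_left_Ioi (fun t => ((evenKernel 0 t - 1 : ℝ) : ℂ)) 0 (inv_pos.2 hy),
      mul_zero, integral_evenKernel_sub_one, inv_inv, Complex.real_smul]
  -- The cut-off is not scale invariant; moving it produces the `-log y`.
  have e2 := (integral_scale_sub_cutInv hy isTame_thetaDual_sub.integrableOn).2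
  rw [regTheta, setIntegral_congr_fun measurableSet_Ioi (thetaQ_sub_cutInv_eqOn x hy),
    integral_add (f := fun t => ((evenKernel 0 (y⁻¹ * t) - 1 : ℝ) : ℂ) +
      (y * thetaDual (y * t) - cutInv t)) (h1.add h2) h3, integral_add h1 h2, e1, e2, thetaDualConst]

/-- The derivative at `s = 1` of `π^s / Γ(s)`. -/
def gammaConst : ℝ := Real.pi * (Real.log Real.pi + Real.eulerMascheroniConstant)

theorem hasDerivAt_pi_cpow_div_Gamma :
    HasDerivAt (fun s : ℂ => (Real.pi : ℂ) ^ s / Complex.Gamma s) (gammaConst : ℂ) 1 := by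
  have hpi : (Real.pi : ℂ) ≠ 0 := by exact_mod_cast Real.pi_ne_zero
  have h1 := (hasDerivAt_id (1 : ℂ)).const_cpow (c := (Real.pi : ℂ)) (Or.inl hpi)
  have h2 := h1.div Complex.hasDerivAt_Gamma_one (by simp)
  convert! h2 using 1
  simp [gammaConst, Complex.ofReal_log Real.pi_pos.le]
  ring

theorem differentiableOn_pi_cpow_div_Gamma :
    DifferentiableOn ℂ (fun s : ℂ => (Real.pi : ℂ) ^ s / Complex.Gamma s) {s | 1 / 2 < s.re} := by
  have hpi : (Real.pi : ℂ) ≠ 0 := by exact_mod_cast Real.pi_ne_zero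
  intro s hs
  have hs' : 0 < s.re := lt_trans (by norm_num) hs
  refine DifferentiableAt.differentiableWithinAt (DifferentiableAt.div ?_ ?_
    (Complex.Gamma_ne_zero_of_re_pos hs'))
  · exact differentiableAt_id.const_cpow (Or.inl hpi)
  · refine Complex.differentiableAt_Gamma s fun m h => ?_
    rw [h] at hs'
    simp at hs'
    linarith [(Nat.cast_nonneg m : (0 : ℝ) ≤ m)]

/-- The regularized value at `s = 1` of the Epstein zeta function of `qform`. -/
theorem isRegularizedEisAtOne_of_qform {X : Type} (e : X ≃ NonzeroPair) {M : X → ℝ} (x : ℝ) {y : ℝ}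
    (hy : 0 < y) (hM : ∀ m, M m = qform x y (e m).1) :
    IsRegularizedEisAtOne M (Real.pi * regTheta x y + (gammaConst : ℂ)) := by
  have hpos : ∀ m, 0 < M m := fun m => by rw [hM]; exact qform_pos x hy _
  have hsr : ∀ s : ℂ, 1 < s.re → Summable fun m => 1 / M m ^ s.re := by
    intro s hs
    simp_rw [hM]
    exact (e.summable_iff (f := fun r : NonzeroPair => 1 / qform x y r.1 ^ s.re)).2
      (summable_qform_rpow x hy hs)
  have hnorm : ∀ (s : ℂ) m, ‖eisTerm M s m‖ = 1 / M m ^ s.re := by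
    intro s m
    rw [eisTerm, Complex.norm_cpow_eq_rpow_re_of_pos (hpos m), Complex.neg_re,
      Real.rpow_neg (hpos m).le, one_div]
  have hsum : ∀ s : ℂ, 1 < s.re → Summable (eisTerm M s) := by
    intro s hs
    refine Summable.of_norm ?_
    simp_rw [hnorm]
    exact hsr s hs
  refine ⟨hsum, Real.pi, ?_⟩
  set H : ℂ → ℂ := fun s => (Real.pi : ℂ) ^ s / Complex.Gamma s with hH
  set k : ℝ → ℂ := fun t => thetaQ x y t - cutInv t with hk
  have hkt : IsTame k := isTame_thetaQ_sub x hy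
  set U : Set ℂ := {s | 1 / 2 < s.re} ∩ {s | s.re < 2}
  have hU : IsOpen U := (isOpen_lt continuous_const Complex.continuous_re).inter
    (isOpen_lt Complex.continuous_re continuous_const)
  have h1U : (1 : ℂ) ∈ U := by constructor <;> norm_num
  have hUn : U ∈ 𝓝 (1 : ℂ) := hU.mem_nhds h1U
  have hHU : DifferentiableOn ℂ H U := differentiableOn_pi_cpow_div_Gamma.mono inter_subset_left
  have hGU : DifferentiableOn ℂ (mellin k) U := fun s hs =>
    (hkt.differentiableAt_mellin hs.1 hs.2).differentiableWithinAt
  have hH1 : H 1 = Real.pi := by simp [hH]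
  have hk1 : mellin k 1 = regTheta x y := by
    rw [mellin, regTheta]; simp [hk]
  -- For `1 < Re s < 2` the series is `H(s) (mellin k s + 1/(s - 1))`. The factor `H` must be
  -- expanded at the pole as well: `H(s)/(s - 1) = π/(s - 1) + dslope H 1 s`, and the last term at
  -- `s = 1` is `H'(1) = gammaConst`.
  refine ⟨fun s => H s * mellin k s + dslope H 1 s, ?_, ?_, ?_⟩
  · exact ((hHU.mul hGU).add ((Complex.differentiableOn_dslope hUn).2 hHU)).analyticAt hUn
  · filter_upwards [hUn] with s hs hs1
    have hs0 : 0 < s.re := by linarith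
    have hG0 : Complex.Gamma s ≠ 0 := Complex.Gamma_ne_zero_of_re_pos hs0
    have hpi : (Real.pi : ℂ) ≠ 0 := by exact_mod_cast Real.pi_ne_zero
    have hne : s ≠ 1 := by rintro rfl; simp at hs1
    have : Countable X := e.injective.countable
    have hm := hasSum_mellin_pi_mul (a := fun _ : X => 1) (q := M) (F := thetaQ x y) (s := s)
      (fun m => Or.inr (hpos m)) hs0 (by
        intro t ht
        have := (hasSum_exp_qform x hy ht)
        rw [← thetaQ_eq x hy ht, ← e.hasSum_iff] at this
        refine this.congr_fun fun m => ?_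
        simp [hM]) (by simpa using hsr s hs1)
    have hm' : HasSum (fun m => (Real.pi : ℂ) ^ (-s) * Complex.Gamma s * eisTerm M s m)
        (mellin (thetaQ x y) s) := by
      refine hm.congr_fun fun m => ?_
      rw [eisTerm, Complex.cpow_neg (M m : ℂ)]
      ring
    have h2 : mellin (thetaQ x y) s = mellin k s + 1 / (s - 1) := by
      have hc := hasMellin_cutInv hs1
      have := hasMellin_add (hkt.mellinConvergent hs.1 hs.2) hc.1
      rw [← hc.2, ← this.2]
      congr 1
      ext t
      simp [hk]
    have h3 := hm'.unique ((hsum s hs1).hasSum.mul_left _)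
    rw [h2] at h3
    have h4 : eis M s = H s * (mellin k s + 1 / (s - 1)) := by
      rw [h3, hH, eis, Complex.cpow_neg]
      have : (Real.pi : ℂ) ^ s ≠ 0 := by simp [Complex.cpow_eq_zero_iff, hpi]
      field_simp
    rw [h4, dslope_of_ne _ hne, slope_def_field, hH1]
    ring
  · simp only [dslope_same, hk1, hH1]
    rw [hasDerivAt_pi_cpow_div_Gamma.deriv]

end OneLoop

end

/-! ### Modular equivariance of the lattice norm, and the case `d = 1`. -/

noncomputable section

namespace OneLoop

open UpperHalfPlane ModularGroup Set HurwitzZeta Asymptotics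
open scoped MatrixGroups

/-- The squared norm `|u + v τ|² / τ₂` for real `u, v`. -/
def modNorm (τ : ℍ) (u v : ℝ) : ℝ := ((u + v * τ.re) ^ 2 + v ^ 2 * τ.im ^ 2) / τ.im

theorem modNorm_eq_qform (τ : ℍ) (r : ℤ × ℤ) : modNorm τ r.1 r.2 = qform τ.re τ.im r := rfl

theorem modNorm_eq_normSq (τ : ℍ) (u v : ℝ) :
    modNorm τ u v = Complex.normSq ((u : ℂ) + v * τ) / τ.im := by
  rw [modNorm, Complex.normSq_apply]
  simp
  ring

theorem coe_sl_smul (g : SL(2, ℤ)) (z : ℍ) : ((g • z : ℍ) : ℂ) =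
    ((g.1 0 0 : ℂ) * z + (g.1 0 1 : ℂ)) / ((g.1 1 0 : ℂ) * z + (g.1 1 1 : ℂ)) := by
  rw [specialLinearGroup_apply]; simp

/-- Numerator and height both acquire the factor `1/|c z + d|²`, which cancels in the quotient. -/
theorem modNorm_smul (g : SL(2, ℤ)) (z : ℍ) (u v : ℝ) :
    modNorm (g • z) u v =
      modNorm z (u * g.1 1 1 + v * g.1 0 1) (u * g.1 1 0 + v * g.1 0 0) := by
  have hd : (g.1 1 0 : ℂ) * z + (g.1 1 1 : ℂ) ≠ 0 := by
    intro h
    have him := (g • z).im_pos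
    rw [im_sl_smul, h] at him
    simp at him
  rw [modNorm_eq_normSq, modNorm_eq_normSq, im_sl_smul, coe_sl_smul]
  have : (u : ℂ) + v * (((g.1 0 0 : ℂ) * z + (g.1 0 1 : ℂ)) / ((g.1 1 0 : ℂ) * z + (g.1 1 1 : ℂ))) =
      (((u * g.1 1 1 + v * g.1 0 1 : ℝ) : ℂ) + ((u * g.1 1 0 + v * g.1 0 0 : ℝ) : ℂ) * z) /
        ((g.1 1 0 : ℂ) * z + (g.1 1 1 : ℂ)) := by
    rw [eq_div_iff hd, add_mul, mul_assoc, div_mul_cancel₀ _ hd]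
    push_cast
    ring
  rw [this, Complex.normSq_div, div_div_div_cancel_right₀]
  exact (Complex.normSq_pos.2 hd).ne'

theorem tsum_nat_add_one_of_even {h : ℤ → ℂ} (heven : ∀ p, h (-p) = h p)
    (hs : Summable fun p : NonzeroInt => h p) :
    ∑' p : ℕ, h (p + 1) = 1 / 2 * ∑' p : NonzeroInt, h p := by
  have h1 := (hasSum_ne_iff (f := h) (b := 0)).1 hs.hasSum
  have h2 : Summable fun p : ℕ => h (p + 1) :=
    h1.summable.comp_injective (i := fun p : ℕ => (p + 1 : ℤ)) fun a b hab => by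
      simpa using hab
  have h3 : HasSum (fun p : ℕ => h p) (∑' p : ℕ, h (p + 1) + h 0) := by
    have := (hasSum_nat_add_iff (f := fun p : ℕ => h p) 1).1 (by simpa using h2.hasSum)
    simpa using this
  have h4 : HasSum (fun p : ℕ => h (-(p + 1))) (∑' p : ℕ, h (p + 1)) := by
    simpa only [heven] using h2.hasSum
  have h5 := h1.unique (h3.of_nat_of_neg_add_one h4)
  linear_combination (-1 / 2 : ℂ) * h5

theorem equivariant_neg {W : ℤ → ℤ → ℍ → ℂ}
    (hW : ∀ (g : SL(2, ℤ)) (m n : ℤ) (z : ℍ),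
      W m n (g • z) = W (m * g.1 1 1 + n * g.1 0 1) (m * g.1 1 0 + n * g.1 0 0) z)
    (m : ℤ) (z : ℍ) : W (-m) 0 z = W m 0 z := by
  have := hW (-1) m 0 z
  rw [ModularGroup.SL_neg_smul, one_smul] at this
  simpa using this.symm

theorem summable_nonzeroInt_of_nonzeroPair {h : ℤ → ℤ → ℂ}
    (hs : Summable fun r : NonzeroPair => h r.1.1 r.1.2) :
    Summable fun p : NonzeroInt => h p 0 :=
  hs.comp_injective (i := fun p : NonzeroInt =>
    (⟨(p.1, 0), fun h0 => p.2 (congrArg Prod.fst h0)⟩ : NonzeroPair)) fun a b hab => by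
      apply Subtype.ext
      exact congrArg (fun r : NonzeroPair => r.1.1) hab

/-- An absolutely convergent sum over nonzero pairs of an equivariant summand, in unfolded form. -/
theorem hasSum_half_tsum_of_equivariant {W : ℤ → ℤ → ℍ → ℂ}
    (hW : ∀ (g : SL(2, ℤ)) (m n : ℤ) (z : ℍ),
      W m n (g • z) = W (m * g.1 1 1 + n * g.1 0 1) (m * g.1 1 0 + n * g.1 0 0) z)
    (hsum : ∀ z, Summable fun r : NonzeroPair => W r.1.1 r.1.2 z) (z : ℍ) :
    HasSum (fun v : CoprimePair => 1 / 2 * ∑' p : NonzeroInt, W p 0 (v.toSL • z))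
      (∑' r : NonzeroPair, W r.1.1 r.1.2 z) := by
  refine (hasSum_coprimePair_of_equivariant hW (hsum z)).congr_fun fun v => ?_
  exact (tsum_nat_add_one_of_even (h := fun p => W p 0 (v.toSL • z))
    (fun p => equivariant_neg hW p _)
    (summable_nonzeroInt_of_nonzeroPair (h := fun m n => W m n (v.toSL • z)) (hsum _))).symm

section DimOne

variable {g B : Matrix (Fin 1) (Fin 1) ℝ}

theorem entry_pos_of_posDef_one (hg : g.PosDef) : 0 < g 0 0 := by
  have := hg.det_pos
  rwa [Matrix.det_fin_one] at this

theorem eq_zero_of_antisymm_one (hB : B.transpose = -B) : B 0 0 = 0 := by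
  have := congrFun (congrFun hB 0) 0
  simp only [Matrix.transpose_apply, Matrix.neg_apply] at this
  linarith

theorem vol_one_sq (hg : g.PosDef) : vol g ^ 2 = g 0 0 := by
  rw [vol, Matrix.det_fin_one, Real.sq_sqrt (entry_pos_of_posDef_one hg).le]

theorem vol_pos {d : ℕ} {g : Matrix (Fin d) (Fin d) ℝ} (hg : g.PosDef) : 0 < vol g :=
  Real.sqrt_pos.2 hg.det_pos

theorem Z_one_eq (hg : g.PosDef) (hB : B.transpose = -B) (τ : ℍ) :
    Z g B τ = vol g + ∑' r : NonzeroPair,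
      (vol g * Real.exp (-Real.pi * qform τ.re τ.im r.1 * g 0 0) : ℂ) := by
  have hs := hasSum_exp_qform τ.re τ.im_pos (entry_pos_of_posDef_one hg)
  have hall := ((hasSum_ne_iff (b := 0) (f := fun r : ℤ × ℤ =>
    (Real.exp (-Real.pi * qform τ.re τ.im r * g 0 0) : ℂ))).1 hs).tsum_eq
  rw [tsum_mul_left, hs.tsum_eq, Z]
  have h0 : qform τ.re τ.im 0 = 0 := by simp [qform]
  have hval : (vol g : ℂ) * ∑' r : ℤ × ℤ, (Real.exp (-Real.pi * qform τ.re τ.im r * g 0 0) : ℂ) =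
      vol g + vol g * (((evenKernel 0 (τ.im⁻¹ * g 0 0) - 1 : ℝ) : ℂ) +
        τ.im * thetaDual (τ.im * g 0 0) + bessSum τ.re τ.im (g 0 0)) := by
    rw [hall, h0]
    simp
    ring
  rw [← hval]
  congr 1
  let e : (Fin 1 → ℤ) × (Fin 1 → ℤ) ≃ ℤ × ℤ :=
    (Equiv.funUnique (Fin 1) ℤ).prodCongr (Equiv.funUnique (Fin 1) ℤ)
  rw [← e.tsum_eq]
  refine tsum_congr fun p => ?_
  rw [Complex.ofReal_exp]
  congr 1
  simp only [Finset.univ_unique, Fin.default_eq_zero, Finset.sum_singleton,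
    eq_zero_of_antisymm_one hB, add_zero]
  have hn : ((p.1 0 : ℂ) + (τ : ℂ) * (p.2 0 : ℂ)) * (g 0 0 : ℂ) *
      ((p.1 0 : ℂ) + (starRingEnd ℂ) (τ : ℂ) * (p.2 0 : ℂ)) =
      g 0 0 * (Complex.normSq ((p.1 0 : ℂ) + (τ : ℂ) * (p.2 0 : ℂ)) : ℂ) := by
    rw [Complex.normSq_eq_conj_mul_self]
    simp only [map_add, map_mul, map_intCast]
    ring
  rw [hn]
  have hq : qform τ.re τ.im (e p) = Complex.normSq ((p.1 0 : ℂ) + (τ : ℂ) * (p.2 0 : ℂ)) / τ.im := by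
    rw [← modNorm_eq_qform, modNorm_eq_normSq]
    simp [e, mul_comm]
  rw [hq]
  push_cast
  ring

/-- The zero vector gives `V π/3`. The others unfold to `V (θ(g₀₀ t) - 1)/2` in `t = 1/τ₂`, with
total `V (π/3)/g₀₀ = (π/3)/V` because `g₀₀ = V²`. -/
theorem modularIntegral_one (hg : g.PosDef) (hB : B.transpose = -B) :
    IntegrableOn (Z g B) fd ∧
    modularIntegral g B = 2 * Real.pi * (vol g * (Real.pi / 3) + Real.pi / 3 / vol g) := by
  have hV := vol_pos hg
  have hG := entry_pos_of_posDef_one hg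
  let W : ℤ → ℤ → ℍ → ℂ := fun m n τ => vol g * Real.exp (-Real.pi * modNorm τ m n * g 0 0)
  have hW : ∀ (γ : SL(2, ℤ)) (m n : ℤ) (z : ℍ),
      W m n (γ • z) = W (m * γ.1 1 1 + n * γ.1 0 1) (m * γ.1 1 0 + n * γ.1 0 0) z := by
    intro γ m n z
    simp only [W, modNorm_smul]
    push_cast
    rfl
  have hsum : ∀ z, Summable fun r : NonzeroPair => W r.1.1 r.1.2 z := fun z =>
    (hasSum_exp_qform z.re z.im_pos hG).summable.mul_left _
  set φ : ℝ → ℂ := fun t => vol g / 2 * ((evenKernel 0 (g 0 0 * t) - 1 : ℝ) : ℂ) with hφ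
  have hf : ∀ z : ℍ, 1 / 2 * ∑' p : NonzeroInt, W p 0 z = φ (z.im)⁻¹ := by
    intro z
    have h1 := Complex.hasSum_ofReal.2
      (hasSum_exp_sq_nonzeroInt (mul_pos hG (inv_pos.2 z.im_pos)))
    rw [hφ]
    simp only
    rw [← h1.tsum_eq, ← tsum_mul_left, ← tsum_mul_left]
    refine tsum_congr fun p => ?_
    simp only [W, modNorm]
    have : -Real.pi * ((((p.1 : ℝ) + ((0 : ℤ) : ℝ) * z.re) ^ 2 + ((0 : ℤ) : ℝ) ^ 2 * z.im ^ 2) / z.im) *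
        g 0 0 = -Real.pi * (p.1 : ℝ) ^ 2 * (g 0 0 * z.im⁻¹) := by
      simp only [Int.cast_zero]
      ring
    rw [this]
    ring
  have hF : ∀ z, HasSum (fun v : CoprimePair => φ ((v.toSL • z).im)⁻¹) (Z g B z - vol g) := by
    intro z
    rw [Z_one_eq hg hB, add_sub_cancel_left]
    exact (hasSum_half_tsum_of_equivariant hW hsum z).congr_fun fun v => (hf _).symm
  have htame : IsTame φ :=
    (isTame_evenKernel_sub_one.comp_mul_left hG).const_mul _
  have hint : Integrable (fun y => φ y⁻¹) radial := by
    rw [integrable_radial_inv]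
    simpa only [inv_inv] using htame.integrableOn
  obtain ⟨i1, i2⟩ := integral_fd_of_unfold (f := fun z => φ z.im⁻¹) hF
    (fun k z => by simp only [im_T_zpow_smul]) (integrableOn_strip_im (fun y => φ y⁻¹) hint)
  refine ⟨i1, ?_⟩
  rw [modularIntegral, i2, setIntegral_strip_im (fun y => φ y⁻¹), integral_radial_inv]
  simp only [inv_inv]
  rw [hφ, integral_const_mul, integral_comp_mul_left_Ioi
    (fun t => ((evenKernel 0 t - 1 : ℝ) : ℂ)) 0 hG, mul_zero, integral_evenKernel_sub_one,
    Complex.real_smul, ← vol_one_sq hg]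
  have : (vol g : ℂ) ≠ 0 := by exact_mod_cast hV.ne'
  push_cast
  field_simp

theorem hasSum_eis_spinor_one (hg : g.PosDef) :
    HasSum (eisTerm (spinorMass g) 1) ((Real.pi ^ 2 / 3 / vol g : ℝ) : ℂ) := by
  have hV := vol_pos hg
  let e : SpinorCharge 1 ≃ NonzeroInt :=
    (Equiv.funUnique (Fin 1) ℤ).subtypeEquiv fun m => by
      rw [not_iff_not]
      constructor
      · intro h; rw [h]; rfl
      · intro h; ext i; rw [Subsingleton.elim i 0]; exact h
  have h1 := Complex.hasSum_ofReal.2 (hasSum_one_div_sq_nonzeroInt.mul_right (vol g)⁻¹)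
  rw [← e.hasSum_iff] at h1
  refine HasSum.congr_fun (g := eisTerm (spinorMass g) 1) h1 fun m => ?_
  rw [eisTerm, Complex.cpow_neg_one, ← Complex.ofReal_inv]
  simp only [Function.comp]
  congr 1
  rw [spinorMass]
  simp only [Finset.univ_unique, Fin.default_eq_zero, Finset.sum_singleton, ← vol_one_sq hg]
  change _ = 1 / ((m.1 0 : ℤ) : ℝ) ^ 2 * (vol g)⁻¹
  have : ((m.1 0 : ℤ) : ℝ) ≠ 0 := by exact_mod_cast (e m).2
  field_simp

theorem hasSum_eis_conjSpinor_one (hg : g.PosDef) :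
    HasSum (eisTerm (conjSpinorMass g B) 1) ((Real.pi ^ 2 / 3 * vol g : ℝ) : ℂ) := by
  have hV := vol_pos hg
  have hz : ∀ m : ConjSpinorCharge 1, m.1.2 = 0 := by
    intro m
    ext i j
    have := congrFun (congrFun m.2.1 i) j
    rw [Subsingleton.elim i 0, Subsingleton.elim j 0] at this ⊢
    simp only [Matrix.transpose_apply, Matrix.neg_apply] at this
    simp only [Matrix.zero_apply]
    omega
  let e : ConjSpinorCharge 1 ≃ NonzeroInt :=
    { toFun := fun m => ⟨m.1.1, fun h => m.2.2 (Prod.ext h (hz m))⟩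
      invFun := fun n => ⟨(n.1, 0), by simp, fun h => n.2 (congrArg Prod.fst h)⟩
      left_inv := fun m => Subtype.ext (Prod.ext rfl (hz m).symm)
      right_inv := fun n => rfl }
  have h1 := Complex.hasSum_ofReal.2 (hasSum_one_div_sq_nonzeroInt.mul_right (vol g))
  rw [← e.hasSum_iff] at h1
  refine HasSum.congr_fun (g := eisTerm (conjSpinorMass g B) 1) h1 fun m => ?_
  rw [eisTerm, Complex.cpow_neg_one, ← Complex.ofReal_inv]
  simp only [Function.comp]
  congr 1
  rw [conjSpinorMass, hz m]
  change _ = 1 / ((m.1.1 : ℤ) : ℝ) ^ 2 * (vol g)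
  simp

end DimOne

end OneLoop

end

/-! ### Strip integrals of the nondegenerate terms for `d = 2`. -/

noncomputable section

namespace OneLoop

open UpperHalfPlane ModularGroup Set HurwitzZeta Asymptotics
open scoped MatrixGroups

theorem integrable_tsum_of_summable_integral_norm {ι α : Type*} [Countable ι] [MeasurableSpace α]
    {μ : Measure α} [SFinite μ] {F : ι → α → ℂ} (hm : ∀ i, Measurable (F i))
    (hF : ∀ i, Integrable (F i) μ) (hs : Summable fun i => ∫ x, ‖F i x‖ ∂μ) :
    Integrable (fun x => ∑' i, F i x) μ := by
  let _ : MeasurableSpace ι := ⊤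
  have : MeasurableSingletonClass ι := ⟨fun _ => trivial⟩
  let G : ι × α → ℂ := fun p => F p.1 p.2
  have hG : Measurable G := measurable_from_prod_countable_right hm
  have hint : Integrable G ((Measure.count : Measure ι).prod μ) := by
    rw [integrable_prod_iff hG.aestronglyMeasurable]
    exact ⟨Eventually.of_forall hF, integrable_count_iff.2 hs.norm⟩
  refine hint.integral_prod_right.congr ?_
  filter_upwards [hint.prod_left_ae] with x hx
  rw [integral_countable hx]
  simp [Measure.real, G]

theorem continuousAt_evenKernel (a : ℝ) {t : ℝ} (ht : 0 < t) :
    ContinuousAt (fun p : ℝ × ℝ => evenKernel p.1 p.2) (a, t) := by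
  have h : ContinuousAt (fun p : ℝ × ℝ => (evenKernel p.1 p.2 : ℂ)) (a, t) := by
    simp only [evenKernel_def]
    refine ContinuousAt.mul (by fun_prop) ?_
    exact ContinuousAt.comp (x := (a, t)) (g := fun p : ℂ × ℂ => jacobiTheta₂ p.1 p.2)
      (f := fun p : ℝ × ℝ => ((p.1 : ℂ) * Complex.I * p.2, Complex.I * (p.2 : ℂ)))
      (continuousAt_jacobiTheta₂ (a * Complex.I * t) (τ := Complex.I * t) (by simpa))
      (Continuous.continuousAt (by fun_prop))
  exact (Complex.continuous_re.continuousAt.comp h)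

theorem continuous_evenKernel {t : ℝ} (ht : 0 < t) : Continuous fun u : ℝ => evenKernel u t :=
  continuous_iff_continuousAt.2 fun a =>
    (continuousAt_evenKernel a ht).comp (f := fun u : ℝ => (u, t)) (by fun_prop)

/-- The sum over integer translates unfolds the unit interval to the real line, leaving one Gaussian
integral. -/
theorem integral_evenKernel_unit {t : ℝ} (ht : 0 < t) :
    ∫ u in (0 : ℝ)..1, evenKernel u t = 1 / √t := by
  have hpt : 0 < Real.pi * t := by positivity
  have hg : Integrable fun u : ℝ => Real.exp (-(Real.pi * t) * u ^ 2) := integrable_exp_neg_mul_sq hpt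
  have h1 := hg.hasSum_intervalIntegral_comp_add_int
  have h2 := hasSum_integral_of_summable_integral_norm (μ := volume.restrict (Ioc (0 : ℝ) 1))
    (F := fun (n : ℤ) (u : ℝ) => Real.exp (-(Real.pi * t) * (u + n) ^ 2))
    (fun n => (hg.comp_add_right (n : ℝ)).integrableOn) (by
      simp only [Real.norm_of_nonneg (Real.exp_pos _).le]
      simpa only [intervalIntegral.integral_of_le zero_le_one] using h1.summable)
  simp only [intervalIntegral.integral_of_le zero_le_one] at h1 ⊢
  have h3 : ∀ u : ℝ, evenKernel u t = ∑' n : ℤ, Real.exp (-(Real.pi * t) * (u + n) ^ 2) := by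
    intro u
    rw [← (hasSum_int_evenKernel u ht).tsum_eq]
    refine tsum_congr fun n => ?_
    congr 1; ring
  simp_rw [h3]
  rw [h2.unique h1, integral_gaussian, one_div, ← Real.sqrt_inv]
  congr 1
  field_simp

/-- As `x` runs over unit length the argument runs over `n` whole periods, so the shift `c` drops
out. -/
theorem integral_evenKernel_comp_int_mul_add {t : ℝ} (ht : 0 < t) {n : ℤ} (hn : n ≠ 0) (c : ℝ) :
    ∫ x in Ico (-1 / 2 : ℝ) (1 / 2), evenKernel (n * x + c : ℝ) t = 1 / √t := by
  have hper : Function.Periodic (fun u : ℝ => evenKernel u t) 1 := by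
    intro u
    simp
  have hnr : (n : ℝ) ≠ 0 := by exact_mod_cast hn
  rw [integral_Ico_eq_integral_Ioc, ← intervalIntegral.integral_of_le (by norm_num),
    intervalIntegral.integral_comp_mul_add (fun u : ℝ => evenKernel u t) hnr c,
    show (n : ℝ) * (1 / 2) + c = ((n : ℝ) * (-1 / 2) + c) + n • (1 : ℝ) by simp; ring,
    hper.intervalIntegral_add_zsmul_eq n _ fun a b => (continuous_evenKernel ht).intervalIntegrable a b,
    hper.intervalIntegral_add_eq _ 0, zero_add, integral_evenKernel_unit ht]
  simp [hnr]

/-- The `(p, n)` term of the nondegenerate part of the unfolded `T²` lattice sum, without its phase,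
as a function of `(τ₁, τ₂)`. -/
def stripKernel (V x y : ℝ) (p n : ℤ) (q : ℝ × ℝ) : ℝ :=
  V * Real.exp (-Real.pi * (V * y * p ^ 2 / q.2 + V / y * n ^ 2 * q.2)) *
    evenKernel (n * q.1 + p * x : ℝ) (V / y / q.2)

variable {V y : ℝ}

theorem stripKernel_nonneg (hV : 0 < V) (x : ℝ) (hy : 0 < y) (p n : ℤ) {q : ℝ × ℝ}
    (hq : 0 < q.2) : 0 ≤ stripKernel V x y p n q :=
  mul_nonneg (mul_nonneg hV.le (Real.exp_pos _).le) (evenKernel_nonneg _ (by positivity))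

theorem continuous_stripKernel (hV : 0 < V) (x : ℝ) (hy : 0 < y) (p n : ℤ) :
    Continuous fun τ : ℍ => stripKernel V x y p n (reIm τ) := by
  have him : Continuous fun τ : ℍ => τ.im := continuous_im
  have hre : Continuous fun τ : ℍ => τ.re := continuous_re
  have h0 : ∀ τ : ℍ, τ.im ≠ 0 := fun τ => τ.im_pos.ne'
  simp only [stripKernel, reIm]
  refine Continuous.mul (continuous_const.mul (Real.continuous_exp.comp (continuous_const.mul
    ((continuous_const.div him h0).add (continuous_const.mul him))))) ?_
  refine continuous_iff_continuousAt.2 fun τ => ?_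
  have hpos : 0 < V / y / τ.im := by have := τ.im_pos; positivity
  exact (continuousAt_evenKernel (n * τ.re + p * x) hpos).comp
    (f := fun τ : ℍ => ((n : ℝ) * τ.re + p * x, V / y / τ.im))
    ((((continuous_const.mul hre).add continuous_const).prodMk
      (continuous_const.div him h0)).continuousAt)

/-- Integrating over `τ₁` eliminates `x`. In `t = 1/τ₂` the parameter `y` survives only as a scale,
which the `t`-integration then removes, and `V` takes the place that `y` has in the expansion of
`thetaQ x y`. -/
theorem integral_stripKernel_re (hV : 0 < V) (x : ℝ) (hy : 0 < y) (p : ℤ) {n : ℤ} (hn : n ≠ 0)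
    {t : ℝ} (ht : 0 < t) :
    ∫ u in Ico (-1 / 2 : ℝ) (1 / 2), stripKernel V x y p n (u, t⁻¹) = y * bess V p n (y * t) := by
  have hpos : 0 < V / y / t⁻¹ := by positivity
  simp only [stripKernel]
  rw [integral_const_mul, integral_evenKernel_comp_int_mul_add hpos hn, bess]
  have h1 : V * (1 / √(V / y / t⁻¹)) = y * √(V / (y * t)) := by
    have e1 : V / y / t⁻¹ = V * (t / y) := by field_simp
    have e2 : V / (y * t) = V * (t / y) * (1 / t) ^ 2 := by field_simp
    rw [e1, e2, Real.sqrt_mul (x := V * (t / y)) (by positivity), Real.sqrt_sq (by positivity)]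
    have e3 : √(V * (t / y)) ≠ 0 := (Real.sqrt_pos.2 (by positivity)).ne'
    have e4 : √(V * (t / y)) ^ 2 = V * (t / y) := Real.sq_sqrt (by positivity)
    rw [mul_one_div, div_eq_iff e3]
    have : y * (√(V * (t / y)) * (1 / t)) * √(V * (t / y)) = y * (1 / t) * √(V * (t / y)) ^ 2 := by
      ring
    rw [this, e4]
    field_simp
  have h2 : -Real.pi * (V * y * p ^ 2 / t⁻¹ + V / y * n ^ 2 * t⁻¹) =
      -Real.pi * V * (y * t * p ^ 2 + n ^ 2 / (y * t)) := by
    field_simp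
  rw [h2, mul_right_comm, h1]
  ring

theorem integrableOn_scaled_bess (hV : 0 < V) (hy : 0 < y) (q : NonzeroInt × NonzeroInt) :
    IntegrableOn (fun t => ((y * bess V q.1 q.2 (y * t) : ℝ) : ℂ)) (Ioi 0) := by
  have h := (integrableOn_Ioi_comp_mul_left_iff (bess V q.1 q.2) 0 hy).2 (by
    rw [mul_zero]; exact integrableOn_bess hV q)
  exact (h.const_mul y).ofReal

theorem integral_scaled_bess (hy : 0 < y) (p n : ℤ) :
    ∫ t in Ioi 0, ((y * bess V p n (y * t) : ℝ) : ℂ) = ((∫ t in Ioi 0, bess V p n t : ℝ) : ℂ) := by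
  rw [integral_complex_ofReal, integral_const_mul, integral_comp_mul_left_Ioi (bess V p n) 0 hy,
    mul_zero, smul_eq_mul, mul_inv_cancel_left₀ hy.ne']

theorem integral_stripKernel_ae (hV : 0 < V) (x : ℝ) (hy : 0 < y) (q : NonzeroInt × NonzeroInt) :
    (fun v : ℝ => ((∫ u in Ico (-1 / 2 : ℝ) (1 / 2), stripKernel V x y q.1 q.2 (u, v) : ℝ) : ℂ))
      =ᵐ[radial] fun v => ((y * bess V q.1 q.2 (y * v⁻¹) : ℝ) : ℂ) := by
  filter_upwards [radial_ae_pos] with v hv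
  rw [← integral_stripKernel_re hV x hy q.1 q.2.2 (inv_pos.2 hv), inv_inv]

theorem integrable_stripKernel (hV : 0 < V) (x : ℝ) (hy : 0 < y) (q : NonzeroInt × NonzeroInt) :
    Integrable (fun r => (stripKernel V x y q.1 q.2 r : ℂ))
      (((volume : Measure ℝ).restrict (Ico (-1 / 2) (1 / 2))).prod radial) := by
  have hmeas : AEStronglyMeasurable (fun r => (stripKernel V x y q.1 q.2 r : ℂ))
      (((volume : Measure ℝ).restrict (Ico (-1 / 2) (1 / 2))).prod radial) := by
    rw [← map_reIm_strip, measurableEmbedding_reIm.aestronglyMeasurable_map_iff]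
    exact (Complex.continuous_ofReal.comp
      (continuous_stripKernel hV x hy q.1 q.2)).aestronglyMeasurable
  rw [integrable_prod_iff' hmeas]
  constructor
  · filter_upwards [radial_ae_pos] with v hv
    have hpos : 0 < V / y / v := by positivity
    refine IntegrableOn.mono_set (ContinuousOn.integrableOn_Icc ?_) Ico_subset_Icc_self
    refine Continuous.continuousOn (Complex.continuous_ofReal.comp ?_)
    simp only [stripKernel]
    exact continuous_const.mul ((continuous_evenKernel hpos).comp
      (f := fun u : ℝ => ((q.2 : ℤ) : ℝ) * u + ((q.1 : ℤ) : ℝ) * x) (by fun_prop))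
  · have h1 : Integrable (fun v => ((y * bess V q.1 q.2 (y * v⁻¹) : ℝ) : ℂ)) radial := by
      rw [integrable_radial_inv]
      simpa only [inv_inv] using integrableOn_scaled_bess hV hy q
    have h2 := (h1.congr (integral_stripKernel_ae hV x hy q).symm).re
    refine h2.congr ?_
    filter_upwards [radial_ae_pos] with v hv
    simp only [RCLike.re_eq_complex_re, Complex.ofReal_re]
    refine integral_congr_ae (Eventually.of_forall fun u => ?_)
    simp only [Complex.norm_real]
    rw [Real.norm_of_nonneg (stripKernel_nonneg hV x hy _ _ hv)]

theorem integral_stripKernel (hV : 0 < V) (x : ℝ) (hy : 0 < y) (q : NonzeroInt × NonzeroInt) :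
    IntegrableOn (fun τ => (stripKernel V x y q.1 q.2 (reIm τ) : ℂ)) strip ∧
    ∫ τ in strip, (stripKernel V x y q.1 q.2 (reIm τ) : ℂ) =
      ((∫ t in Ioi 0, bess V q.1 q.2 t : ℝ) : ℂ) := by
  have h := integrable_stripKernel hV x hy q
  refine ⟨(integrableOn_strip_iff fun r => (stripKernel V x y q.1 q.2 r : ℂ)).2 h, ?_⟩
  rw [setIntegral_strip (fun r => (stripKernel V x y q.1 q.2 r : ℂ)), integral_prod_symm _ h]
  simp only [integral_complex_ofReal]
  rw [← integral_complex_ofReal, integral_congr_ae (integral_stripKernel_ae hV x hy q),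
    integral_radial_inv]
  simp only [inv_inv]
  exact integral_scaled_bess hy _ _

/-- The nondegenerate terms reproduce the Bessel part of `regTheta b V`. Each kernel is positive and
each phase has modulus 1, so the sums of the norms are the integrals of `bess`, already known to be
summable. -/
theorem integral_stripKernel_tsum (hV : 0 < V) (b x : ℝ) (hy : 0 < y) :
    IntegrableOn (fun τ : ℍ => ∑' q : NonzeroInt × NonzeroInt,
      phase b q.1 q.2 * (stripKernel V x y q.1 q.2 (reIm τ) : ℂ)) strip ∧
    ∫ τ in strip, ∑' q : NonzeroInt × NonzeroInt,
      phase b q.1 q.2 * (stripKernel V x y q.1 q.2 (reIm τ) : ℂ) =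
      ∫ t in Ioi 0, bessSum b V t := by
  have hi : ∀ q : NonzeroInt × NonzeroInt, Integrable (fun τ =>
      phase b q.1 q.2 * (stripKernel V x y q.1 q.2 (reIm τ) : ℂ)) (volume.restrict strip) :=
    fun q => (integral_stripKernel hV x hy q).1.const_mul _
  have hn : ∀ q : NonzeroInt × NonzeroInt, ∫ τ in strip,
      ‖phase b q.1 q.2 * (stripKernel V x y q.1 q.2 (reIm τ) : ℂ)‖ =
      ∫ t in Ioi 0, bess V q.1 q.2 t := by
    intro q
    have h := (integral_stripKernel hV x hy q).2
    rw [integral_complex_ofReal, Complex.ofReal_inj] at h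
    rw [← h]
    refine integral_congr_ae (Eventually.of_forall fun τ => ?_)
    simp only [norm_mul, norm_phase, one_mul, Complex.norm_real]
    rw [Real.norm_of_nonneg (stripKernel_nonneg hV x hy _ _ τ.im_pos)]
  have hs : Summable fun q : NonzeroInt × NonzeroInt => ∫ τ in strip,
      ‖phase b q.1 q.2 * (stripKernel V x y q.1 q.2 (reIm τ) : ℂ)‖ := by
    simp_rw [hn]
    exact summable_integral_bess hV
  refine ⟨integrable_tsum_of_summable_integral_norm (fun q => ?_) hi hs, ?_⟩
  · exact (continuous_const.mul (Complex.continuous_ofReal.comp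
      (continuous_stripKernel hV x hy q.1 q.2))).measurable
  · refine (hasSum_integral_of_summable_integral_norm hi hs).unique ?_
    refine (hasSum_integral_bessSum b hV).congr_fun fun q => ?_
    rw [integral_const_mul, (integral_stripKernel hV x hy q).2]

end OneLoop

end

/-! ### The `T²` lattice sum: convergence, equivariance, and splitting into degenerate and
nondegenerate parts. -/

noncomputable section

namespace OneLoop

open UpperHalfPlane ModularGroup Set HurwitzZeta Asymptotics
open scoped MatrixGroups

/-- A term of the `T²` lattice sum in terms of the volume `V`, the complex structure `x + i y` and
the two-form `b`; `r` and `s` are the pairs `(m^i, n^i)` for the two circles. -/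
def latticeTerm (V x y b : ℝ) (r s : ℤ × ℤ) (τ : ℍ) : ℂ :=
  phase b 1 (r.1 * s.2 - r.2 * s.1) *
    (Real.exp (-Real.pi * (V * y * modNorm τ r.1 r.2 +
      V / y * modNorm τ (s.1 + x * r.1) (s.2 + x * r.2))) : ℂ)

theorem summable_exp_qform {x y t : ℝ} (hy : 0 < y) (ht : 0 < t) :
    Summable fun r : ℤ × ℤ => Real.exp (-Real.pi * qform x y r * t) := by
  have := ((hasSum_ne_iff (b := 0) (f := fun r : ℤ × ℤ =>
    (Real.exp (-Real.pi * qform x y r * t) : ℂ))).1 (hasSum_exp_qform x hy ht)).summable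
  exact Complex.summable_ofReal.1 this

variable {V x y b : ℝ}

/-- The exponent couples the binary form of `x + i y` with that of `τ`. Bounding the former below by
a multiple of the identity decouples `r` from `s` and leaves a product of two theta series. -/
theorem summable_latticeTerm (hV : 0 < V) (hy : 0 < y) (τ : ℍ) :
    Summable fun p : (ℤ × ℤ) × (ℤ × ℤ) => latticeTerm V x y b p.1 p.2 τ := by
  obtain ⟨c, hc, h⟩ := exists_binaryForm_lower_bound x hy
  have h1 := summable_exp_qform (x := τ.re) τ.im_pos (mul_pos hV hc)
  refine Summable.of_norm_bounded (h1.mul_of_nonneg h1 (fun _ => (Real.exp_pos _).le)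
    (fun _ => (Real.exp_pos _).le)) fun p => ?_
  obtain ⟨r, s⟩ := p
  rw [latticeTerm, norm_mul, norm_phase, one_mul, Complex.norm_real,
    Real.norm_of_nonneg (Real.exp_pos _).le, ← Real.exp_add]
  refine Real.exp_le_exp.2 ?_
  rw [← modNorm_eq_qform, ← modNorm_eq_qform]
  have h2 := h (s.1 + s.2 * τ.re) (r.1 + r.2 * τ.re)
  have h3 := h s.2 r.2
  have hi := τ.im_pos
  have key : V * c * (modNorm τ r.1 r.2 + modNorm τ s.1 s.2) ≤ V * y * modNorm τ r.1 r.2 +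
      V / y * modNorm τ (s.1 + x * r.1) (s.2 + x * r.2) := by
    have e1 : V * c * (modNorm τ r.1 r.2 + modNorm τ s.1 s.2) =
        V / τ.im * (c * ((s.1 + s.2 * τ.re) ^ 2 + (r.1 + r.2 * τ.re) ^ 2) +
          τ.im ^ 2 * (c * ((s.2 : ℝ) ^ 2 + (r.2 : ℝ) ^ 2))) := by
      rw [modNorm, modNorm]; ring
    have e2 : V * y * modNorm τ r.1 r.2 + V / y * modNorm τ (s.1 + x * r.1) (s.2 + x * r.2) =
        V / τ.im * ((((s.1 + s.2 * τ.re) + (r.1 + r.2 * τ.re) * x) ^ 2 +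
          (r.1 + r.2 * τ.re) ^ 2 * y ^ 2) / y + τ.im ^ 2 *
          ((((s.2 : ℝ) + r.2 * x) ^ 2 + (r.2 : ℝ) ^ 2 * y ^ 2) / y)) := by
      rw [modNorm, modNorm]; field_simp; ring
    rw [e1, e2]
    gcongr
  nlinarith [mul_le_mul_of_nonneg_left key Real.pi_pos.le]

/-- The right action of `SL(2,ℤ)` on pairs `(m, n)`. -/
def pairAct (g : SL(2, ℤ)) : ℤ × ℤ ≃ ℤ × ℤ where
  toFun r := (r.1 * g.1 1 1 + r.2 * g.1 0 1, r.1 * g.1 1 0 + r.2 * g.1 0 0)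
  invFun r := (r.1 * g.1 0 0 - r.2 * g.1 0 1, r.2 * g.1 1 1 - r.1 * g.1 1 0)
  left_inv r := by
    have hd := g.2
    rw [Matrix.det_fin_two] at hd
    refine Prod.ext ?_ ?_
    · linear_combination r.1 * hd
    · linear_combination r.2 * hd
  right_inv r := by
    have hd := g.2
    rw [Matrix.det_fin_two] at hd
    refine Prod.ext ?_ ?_
    · linear_combination r.1 * hd
    · linear_combination r.2 * hd

/-- The phase depends on `(r, s)` only through its determinant, which `SL(2,ℤ)` preserves; the norms
are handled by `modNorm_smul`. -/
theorem latticeTerm_smul (g : SL(2, ℤ)) (r s : ℤ × ℤ) (τ : ℍ) :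
    latticeTerm V x y b r s (g • τ) = latticeTerm V x y b (pairAct g r) (pairAct g s) τ := by
  have hd := g.2
  rw [Matrix.det_fin_two] at hd
  simp only [latticeTerm, modNorm_smul, pairAct, Equiv.coe_fn_mk]
  congr 2
  · linear_combination (-(r.1 * s.2 - r.2 * s.1)) * hd
  · push_cast
    congr 5 <;> ring

/-- The weight of the first row in the unfolding of the `T²` lattice sum: the pairs `(r, s)` with
first row `r`, and those with first row zero and second row `r`. -/
def rowWeight (V x y b : ℝ) (m n : ℤ) (τ : ℍ) : ℂ :=
  V * (latticeTerm V x y b 0 (m, n) τ + ∑' s : ℤ × ℤ, latticeTerm V x y b (m, n) s τ)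

theorem rowWeight_smul (g : SL(2, ℤ)) (m n : ℤ) (τ : ℍ) :
    rowWeight V x y b m n (g • τ) =
      rowWeight V x y b (m * g.1 1 1 + n * g.1 0 1) (m * g.1 1 0 + n * g.1 0 0) τ := by
  have h0 : pairAct g 0 = 0 := by simp [pairAct]
  simp only [rowWeight, latticeTerm_smul, h0]
  rw [(pairAct g).tsum_eq fun s => latticeTerm V x y b (pairAct g (m, n)) s τ]
  rfl

theorem latticeTerm_zero_zero (τ : ℍ) : latticeTerm V x y b 0 0 τ = 1 := by
  simp [latticeTerm, phase, modNorm]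

/-- Every nonzero lattice vector is counted once, under its first nonzero row; the subtracted `V` is
the zero vector. -/
theorem hasSum_rowWeight (hV : 0 < V) (hy : 0 < y) (τ : ℍ) :
    HasSum (fun r : NonzeroPair => rowWeight V x y b r.1.1 r.1.2 τ)
      (V * ∑' p : (ℤ × ℤ) × (ℤ × ℤ), latticeTerm V x y b p.1 p.2 τ - V) := by
  have h := summable_latticeTerm (x := x) (b := b) hV hy τ
  have h1 := h.hasSum.prod_fiberwise fun r => (h.prod_factor r).hasSum
  have h2 : HasSum (fun s : ℤ × ℤ => latticeTerm V x y b 0 s τ)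
    (∑' s : ℤ × ℤ, latticeTerm V x y b 0 s τ) := (h.prod_factor 0).hasSum
  have h3 : HasSum (fun s : NonzeroPair => latticeTerm V x y b 0 s τ)
      (∑' s : ℤ × ℤ, latticeTerm V x y b 0 s τ - 1) := by
    refine (hasSum_ne_iff (f := fun s : ℤ × ℤ => latticeTerm V x y b 0 s τ) (b := 0)).2 ?_
    rw [latticeTerm_zero_zero, add_sub_cancel]
    exact h2
  have h4 : HasSum (fun r : NonzeroPair => ∑' s : ℤ × ℤ, latticeTerm V x y b r.1 s τ)
      (∑' p : (ℤ × ℤ) × (ℤ × ℤ), latticeTerm V x y b p.1 p.2 τ -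
        ∑' s : ℤ × ℤ, latticeTerm V x y b 0 s τ) := by
    refine (hasSum_ne_iff (f := fun r : ℤ × ℤ => ∑' s : ℤ × ℤ, latticeTerm V x y b r s τ)
      (b := 0)).2 ?_
    rw [add_sub_cancel]
    exact h1
  have h5 := (h3.add h4).mul_left (V : ℂ)
  convert! h5 using 1
  ring

theorem phase_one_mul (p n : ℤ) : phase b 1 (p * n) = phase b p n := by
  rw [phase, phase]
  congr 1
  push_cast
  ring

/-- The determinant `p n` does not involve `m`, so the phase factors out and a shifted Gaussian sum
in `m` remains. -/
theorem hasSum_latticeTerm_row (hV : 0 < V) (hy : 0 < y) (p n : ℤ) (τ : ℍ) :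
    HasSum (fun m : ℤ => (V : ℂ) * latticeTerm V x y b (p, 0) (m, n) τ)
      (phase b p n * (stripKernel V x y p n (reIm τ) : ℂ)) := by
  have hi := τ.im_pos
  have hpos : 0 < V / y / τ.im := by positivity
  have h1 := Complex.hasSum_ofReal.2 ((hasSum_int_evenKernel (n * τ.re + p * x) hpos).mul_left
    (V * Real.exp (-Real.pi * (V * y * p ^ 2 / τ.im + V / y * n ^ 2 * τ.im))))
  refine (h1.mul_left (phase b p n)).congr_fun fun m => ?_
  rw [latticeTerm]
  simp only [zero_mul, sub_zero, phase_one_mul]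
  rw [mul_left_comm, ← Complex.ofReal_mul, mul_assoc V (Real.exp _), ← Real.exp_add]
  congr 4
  simp only [modNorm, Int.cast_zero]
  field_simp
  ring

theorem latticeTerm_zero_left (hy : 0 < y) (m : ℤ) (τ : ℍ) :
    latticeTerm V x y b 0 (m, 0) τ =
      (Real.exp (-Real.pi * qform x y (m, 0) * (V / τ.im)) : ℂ) := by
  have hi := τ.im_pos
  have : phase b 1 ((0 : ℤ × ℤ).1 * ((m, 0) : ℤ × ℤ).2 - (0 : ℤ × ℤ).2 * ((m, 0) : ℤ × ℤ).1) = 1 := by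
    simp [phase]
  rw [latticeTerm, this, one_mul]
  congr 2
  simp only [modNorm, qform, Prod.fst_zero, Prod.snd_zero, Int.cast_zero]
  field_simp
  ring

theorem latticeTerm_degenerate (hy : 0 < y) (p m : ℤ) (τ : ℍ) :
    latticeTerm V x y b (p, 0) (m, 0) τ =
      (Real.exp (-Real.pi * qform x y (m, p) * (V / τ.im)) : ℂ) := by
  have hi := τ.im_pos
  have : phase b 1 (((p, 0) : ℤ × ℤ).1 * ((m, 0) : ℤ × ℤ).2 -
      ((p, 0) : ℤ × ℤ).2 * ((m, 0) : ℤ × ℤ).1) = 1 := by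
    simp [phase]
  rw [latticeTerm, this, one_mul]
  congr 2
  simp only [modNorm, qform, Int.cast_zero]
  field_simp
  ring

theorem hasSum_tsum_of_nonzeroPair {h : ℤ × ℤ → ℂ} (hs : Summable fun r : NonzeroPair => h r) :
    (Summable fun m : NonzeroInt => h (m, 0)) ∧
    HasSum (fun k : NonzeroInt => ∑' m : ℤ, h (m, k))
      (∑' r : NonzeroPair, h r - ∑' m : NonzeroInt, h (m, 0)) := by
  have h1 := (hasSum_ne_iff (f := h) (b := 0)).1 hs.hasSum
  have h2 := h1.summable.comp_injective (Equiv.prodComm ℤ ℤ).injective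
  have h3 : HasSum (fun p : ℤ × ℤ => h (p.2, p.1)) (h 0 + ∑' r : NonzeroPair, h r) :=
    (Equiv.prodComm ℤ ℤ).hasSum_iff.2 h1
  have h4 := h3.prod_fiberwise fun k => (h3.summable.prod_factor k).hasSum
  have h5 : Summable fun m : ℤ => h (m, 0) := h3.summable.prod_factor 0
  have h6 : Summable fun m : NonzeroInt => h (m, 0) := h5.comp_injective Subtype.val_injective
  have h7 := (hasSum_ne_iff (f := fun m : ℤ => h (m, 0)) (b := 0)).1 h6.hasSum
  refine ⟨h6, (hasSum_ne_iff (f := fun k : ℤ => ∑' m : ℤ, h (m, k)) (b := 0)).2 ?_⟩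
  rw [h7.tsum_eq]
  convert! h4 using 1
  rw [Prod.mk_zero_zero]
  ring

/-- The unfolded `T²` lattice sum: a degenerate part, a theta series in `τ₂`, and a nondegenerate
part, a series of Poisson-resummed rows. -/
theorem tsum_rowWeight (hV : 0 < V) (hy : 0 < y) (τ : ℍ) :
    ∑' p : NonzeroInt, rowWeight V x y b p 0 τ = V * thetaQ x y (V * τ.im⁻¹) +
      ∑' q : NonzeroInt × NonzeroInt,
        phase b q.1 q.2 * (stripKernel V x y q.1 q.2 (reIm τ) : ℂ) := by
  have hi := τ.im_pos
  have hVi : 0 < V * τ.im⁻¹ := by positivity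
  set ρ : ℤ → ℤ → ℂ := fun p n => phase b p n * (stripKernel V x y p n (reIm τ) : ℂ)
  have hρ : ∀ p n, HasSum (fun m : ℤ => (V : ℂ) * latticeTerm V x y b (p, 0) (m, n) τ) (ρ p n) :=
    fun p n => hasSum_latticeTerm_row hV hy p n τ
  have hs : Summable fun q : (ℤ × ℤ) × ℤ =>
      (V : ℂ) * latticeTerm V x y b (q.1.1, 0) (q.2, q.1.2) τ :=
    ((summable_latticeTerm (x := x) (b := b) hV hy τ).mul_left (V : ℂ)).comp_injective
      (i := fun q : (ℤ × ℤ) × ℤ => ((q.1.1, (0 : ℤ)), (q.2, q.1.2))) (by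
        rintro ⟨⟨p, n⟩, m⟩ ⟨⟨p', n'⟩, m'⟩ h
        simp only [Prod.mk.injEq] at h
        simp [h.1.1, h.2.1, h.2.2])
  have hρs : Summable fun q : ℤ × ℤ => ρ q.1 q.2 :=
    (hs.hasSum.prod_fiberwise fun q => hρ q.1 q.2).summable
  have hρnz : Summable fun q : NonzeroInt × NonzeroInt => ρ q.1 q.2 :=
    hρs.comp_injective (i := fun q : NonzeroInt × NonzeroInt => ((q.1 : ℤ), (q.2 : ℤ)))
      (Subtype.val_injective.prodMap Subtype.val_injective)
  have hN := hρnz.hasSum.prod_fiberwise fun p => (hρnz.prod_factor p).hasSum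
  have hrow : ∀ p : ℤ, V * ∑' s : ℤ × ℤ, latticeTerm V x y b (p, 0) s τ =
      ρ p 0 + ∑' n : NonzeroInt, ρ p n := by
    intro p
    have h1 : Summable fun s : ℤ × ℤ => (V : ℂ) * latticeTerm V x y b (p, 0) s τ :=
      ((summable_latticeTerm (x := x) (b := b) hV hy τ).mul_left (V : ℂ)).prod_factor (p, 0)
    have h2 : HasSum (fun q : ℤ × ℤ => (V : ℂ) * latticeTerm V x y b (p, 0) (q.2, q.1) τ)
        (∑' s : ℤ × ℤ, (V : ℂ) * latticeTerm V x y b (p, 0) s τ) :=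
      (Equiv.prodComm ℤ ℤ).hasSum_iff.2 h1.hasSum
    have h3 := h2.prod_fiberwise fun n => hρ p n
    have h4 : Summable fun n : NonzeroInt => ρ p n :=
      h3.summable.comp_injective Subtype.val_injective
    rw [← tsum_mul_left]
    exact h3.unique ((hasSum_ne_iff (f := fun n : ℤ => ρ p n) (b := 0)).1 h4.hasSum)
  set h : ℤ × ℤ → ℂ := fun r => (Real.exp (-Real.pi * qform x y r * (V * τ.im⁻¹)) : ℂ)
  obtain ⟨t1, t2⟩ := hasSum_tsum_of_nonzeroPair (h := h) (hasSum_exp_qform x hy hVi).summable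
  have hdeg : ∀ p : ℤ, (V : ℂ) * ∑' m : ℤ, h (m, p) = ρ p 0 := by
    intro p
    rw [← (hρ p 0).tsum_eq, tsum_mul_left]
    congr 1
    refine tsum_congr fun m => ?_
    rw [latticeTerm_degenerate hy, div_eq_mul_inv]
  -- `t1` collects the vectors with first row zero and second row `(m, 0)`, `t2` those with rows
  -- `(p, 0)`, `(m, 0)` and `p ≠ 0`. Together they exhaust the theta series of `qform x y`.
  have hfin := ((t1.hasSum.add t2).mul_left (V : ℂ)).add hN
  rw [add_sub_cancel] at hfin
  refine HasSum.tsum_eq (hfin.congr_fun fun p => ?_)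
  rw [rowWeight, mul_add, hrow, latticeTerm_zero_left hy, mul_add, hdeg, div_eq_mul_inv, add_assoc]

end OneLoop

end

/-! ### The case `d = 2`: value of the regularized integral, identification with both Eisenstein
series, and conclusion. -/

noncomputable section

namespace OneLoop

open UpperHalfPlane ModularGroup Set
open scoped MatrixGroups

/-- The integrand left after unfolding the `T²` lattice sum to the strip. -/
def stripWeight (V x y b : ℝ) (τ : ℍ) : ℂ := 1 / 2 * ∑' p : NonzeroInt, rowWeight V x y b p 0 τ

variable {V x y b : ℝ}

/-- In `t = 1/τ₂` the degenerate part is `V * thetaQ x y (V * t)`; scaling `V` away against the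
fixed cut-off costs `log V`. -/
theorem integral_stripWeight_sub (hV : 0 < V) (hy : 0 < y) :
    IntegrableOn (fun z => stripWeight V x y b z - ((1 / 2 * cutIm z.im : ℝ) : ℂ)) strip ∧
    ∫ z in strip, (stripWeight V x y b z - ((1 / 2 * cutIm z.im : ℝ) : ℂ)) =
      1 / 2 * (regTheta x y - (Real.log V : ℂ) + ∫ t in Ioi 0, bessSum b V t) := by
  obtain ⟨i1, i2⟩ := integral_scale_sub_cutInv hV (isTame_thetaQ_sub x hy).integrableOn
  obtain ⟨j1, j2⟩ := integral_stripKernel_tsum hV b x hy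
  set D : ℝ → ℂ := fun u => V * thetaQ x y (V * u⁻¹) - cutInv u⁻¹
  set N : ℍ → ℂ := fun τ => ∑' q : NonzeroInt × NonzeroInt,
    phase b q.1 q.2 * (stripKernel V x y q.1 q.2 (reIm τ) : ℂ)
  have k1 : IntegrableOn (fun z : ℍ => D z.im) strip := by
    refine integrableOn_strip_im D ((integrable_radial_inv D).2 ?_)
    simpa only [D, inv_inv] using i1
  have k2 : ∫ z in strip, D z.im = regTheta x y - (Real.log V : ℂ) := by
    rw [setIntegral_strip_im, integral_radial_inv, regTheta, ← i2]
    simp only [D, inv_inv]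
  have key : (fun z => stripWeight V x y b z - ((1 / 2 * cutIm z.im : ℝ) : ℂ)) =
      fun z : ℍ => 1 / 2 * (D z.im + N z) := by
    ext z
    rw [stripWeight, tsum_rowWeight hV hy]
    simp only [D, N, cutInv, inv_inv]
    push_cast
    ring
  rw [key]
  refine ⟨(k1.add j1).const_mul _, ?_⟩
  rw [integral_const_mul, integral_add k1 j1, k2, j2]

theorem tendsto_integral_latticeSum (hV : 0 < V) (hy : 0 < y) {F : ℍ → ℂ}
    (hF : ∀ τ, F τ = V * ∑' p : (ℤ × ℤ) × (ℤ × ℤ), latticeTerm V x y b p.1 p.2 τ) :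
    (∀ L, IntegrableOn F (truncatedFundamentalDomain L)) ∧
    Tendsto (fun L : ℝ => (∫ z in truncatedFundamentalDomain L, F z) - (Real.log L : ℂ)) atTop
      (𝓝 (regTheta x y + regTheta b V - thetaDualConst)) := by
  obtain ⟨h1, h2⟩ := integral_stripWeight_sub (x := x) (b := b) hV hy
  have hunfold : ∀ z, HasSum (fun v : CoprimePair => stripWeight V x y b (v.toSL • z)) (F z - V) := by
    intro z
    rw [hF, ← (hasSum_rowWeight hV hy z).tsum_eq]
    exact hasSum_half_tsum_of_equivariant rowWeight_smul
      (fun z => (hasSum_rowWeight hV hy z).summable) z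
  have hper : ∀ (k : ℤ) (z : ℍ), stripWeight V x y b (T ^ k • z) = stripWeight V x y b z := by
    intro k z
    simp only [stripWeight, equivariant_T_zpow rowWeight_smul]
  obtain ⟨t1, t2⟩ := tendsto_truncated_integral hunfold hper h1
  refine ⟨t1, ?_⟩
  convert! t2 using 2
  -- The zero vector's `V π/3`, the `-log V` and the Bessel integral are the terms of `regTheta b V`
  -- apart from `thetaDualConst`.
  rw [h2, regTheta_eq b hV]
  ring

variable {g B : Matrix (Fin 2) (Fin 2) ℝ}

theorem symm_of_posDef (hg : g.PosDef) : g 1 0 = g 0 1 := by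
  have := hg.isHermitian.apply 0 1
  simpa using this

theorem diag_pos_of_posDef (hg : g.PosDef) : 0 < g 1 1 := hg.diag_pos

theorem vol_two_sq (hg : g.PosDef) : vol g ^ 2 = g 0 0 * g 1 1 - g 0 1 ^ 2 := by
  rw [vol, Real.sq_sqrt hg.det_pos.le, Matrix.det_fin_two, symm_of_posDef hg, sq]

theorem antisymm_two (hB : B.transpose = -B) : B 0 0 = 0 ∧ B 1 1 = 0 ∧ B 1 0 = -B 0 1 := by
  have h : ∀ i j, B j i = -B i j := fun i j => congrFun (congrFun hB i) j
  exact ⟨by linarith [h 0 0], by linarith [h 1 1], h 0 1⟩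

/-- Vectors in `ℤ² × ℤ²` as pairs `(m^i, n^i)`. -/
def latticeEquiv : (Fin 2 → ℤ) × (Fin 2 → ℤ) ≃ (ℤ × ℤ) × (ℤ × ℤ) :=
  ((finTwoArrowEquiv ℤ).prodCongr (finTwoArrowEquiv ℤ)).trans (Equiv.prodProdProdComm ℤ ℤ ℤ ℤ)

/-- This completes the square in the second coordinate of `g`: with `y = V/g₁₁` one has `V/y = g₁₁`
and `V y = g₀₀ - g₀₁²/g₁₁`. -/
theorem lattice_exponent (hg : g.PosDef) (r s : ℤ × ℤ) (τ : ℍ) :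
    Real.pi * (vol g * (vol g / g 1 1) * modNorm τ r.1 r.2 +
      vol g / (vol g / g 1 1) *
        modNorm τ (s.1 + g 0 1 / g 1 1 * r.1) (s.2 + g 0 1 / g 1 1 * r.2)) =
    Real.pi / τ.im * (g 0 0 * ((r.1 + r.2 * τ.re) ^ 2 + r.2 ^ 2 * τ.im ^ 2) +
      2 * g 0 1 * ((r.1 + r.2 * τ.re) * (s.1 + s.2 * τ.re) + r.2 * s.2 * τ.im ^ 2) +
      g 1 1 * ((s.1 + s.2 * τ.re) ^ 2 + s.2 ^ 2 * τ.im ^ 2)) := by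
  have hV := vol_pos hg
  have h1 := diag_pos_of_posDef hg
  have hi := τ.im_pos
  have e1 : vol g * (vol g / g 1 1) = g 0 0 - g 0 1 ^ 2 / g 1 1 := by
    rw [← mul_div_assoc, ← sq, vol_two_sq hg]
    field_simp
  have e2 : vol g / (vol g / g 1 1) = g 1 1 := by field_simp
  rw [e1, e2, modNorm, modNorm]
  field_simp
  ring

theorem Z_two_eq (hg : g.PosDef) (hB : B.transpose = -B) (τ : ℍ) :
    Z g B τ = vol g * ∑' p : (ℤ × ℤ) × (ℤ × ℤ),
      latticeTerm (vol g) (g 0 1 / g 1 1) (vol g / g 1 1) (B 0 1) p.1 p.2 τ := by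
  obtain ⟨b0, b1, b2⟩ := antisymm_two hB
  have hi : (τ.im : ℂ) ≠ 0 := by exact_mod_cast τ.im_pos.ne'
  rw [Z, ← latticeEquiv.tsum_eq]
  congr 1
  refine tsum_congr fun p => ?_
  obtain ⟨m, n⟩ := p
  have hτ : (τ : ℂ) = τ.re + τ.im * Complex.I := (Complex.re_add_im _).symm
  have hτ2 : (starRingEnd ℂ) (τ : ℂ) = τ.re - τ.im * Complex.I := by
    rw [hτ]
    simp [sub_eq_add_neg]
  have hl : latticeEquiv (m, n) = ((m 0, n 0), (m 1, n 1)) := rfl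
  rw [hl, latticeTerm, phase, Complex.ofReal_exp, ← Complex.exp_add, neg_mul Real.pi,
    lattice_exponent hg]
  congr 1
  simp only [Fin.sum_univ_two, hτ2]
  simp only [hτ, b0, b1, b2, symm_of_posDef hg]
  push_cast
  -- The first multiple replaces `I²` in the metric part. The second cancels `τ₂` against `π/τ₂` in
  -- the antisymmetric part, which leaves the pure phase.
  linear_combination Real.pi * (τ.im : ℂ)⁻¹ * τ.im ^ 2 * (g 0 0 * n 0 ^ 2 + 2 * g 0 1 * (n 0 * n 1) +
    g 1 1 * n 1 ^ 2) * Complex.I_sq +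
    2 * Real.pi * Complex.I * B 0 1 * (m 0 * n 1 - n 0 * m 1) * inv_mul_cancel₀ hi

theorem isRegularizedIntegral_two (hg : g.PosDef) (hB : B.transpose = -B) :
    IsRegularizedIntegral g B (2 * Real.pi * (regTheta (g 0 1 / g 1 1) (vol g / g 1 1) +
      regTheta (B 0 1) (vol g) - thetaDualConst)) := by
  have hV := vol_pos hg
  obtain ⟨h1, h2⟩ := tendsto_integral_latticeSum hV (div_pos hV (diag_pos_of_posDef hg))
    (Z_two_eq hg hB)
  refine ⟨h1, 2 * Real.pi, (h2.const_mul (2 * Real.pi : ℂ)).congr fun L => ?_⟩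
  rw [modularIntegralUpTo]
  ring

/-- Spinor charges for `d = 2` as nonzero pairs. -/
def spinorEquiv : SpinorCharge 2 ≃ NonzeroPair :=
  ((finTwoArrowEquiv ℤ).trans (Equiv.prodComm ℤ ℤ)).subtypeEquiv fun v => by
    simp [funext_iff, Fin.forall_fin_two, Prod.ext_iff, and_comm]

/-- Dividing by `V = √(det g)` makes the metric unimodular, with modulus `(g₀₁ + i V)/g₁₁` for the
charges read as `(m¹, m⁰)`. -/
theorem isRegularizedEis_spinor_two (hg : g.PosDef) :
    IsRegularizedEisAtOne (spinorMass g)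
      (Real.pi * regTheta (g 0 1 / g 1 1) (vol g / g 1 1) + (gammaConst : ℂ)) := by
  have hV := vol_pos hg
  have h1 := diag_pos_of_posDef hg
  refine isRegularizedEisAtOne_of_qform spinorEquiv _ (div_pos hV h1) fun v => ?_
  have he : (spinorEquiv v).1 = (v.1 1, v.1 0) := rfl
  rw [he, spinorMass, qform]
  simp only [Fin.sum_univ_two, symm_of_posDef hg]
  have h0 : g 0 0 = (vol g ^ 2 + g 0 1 ^ 2) / g 1 1 := by
    rw [vol_two_sq hg]
    field_simp
    ring
  rw [h0]
  field_simp
  ring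

/-- Conjugate spinor charges for `d = 2` as nonzero pairs `(m, m^{01})`. -/
def conjSpinorEquiv : ConjSpinorCharge 2 ≃ NonzeroPair where
  toFun c := ⟨(c.1.1, c.1.2 0 1), by
    obtain ⟨⟨m, M⟩, hM, hne⟩ := c
    refine fun h => hne ?_
    have h' : ∀ i j, M j i = -M i j := fun i j => congrFun (congrFun hM i) j
    obtain ⟨hm, h01⟩ := Prod.ext_iff.1 h
    refine Prod.ext hm (Matrix.ext fun i j => ?_)
    have a00 := h' 0 0
    have a11 := h' 1 1
    have a01 := h' 0 1
    simp only [Prod.fst_zero, Prod.snd_zero] at hm h01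
    fin_cases i <;> fin_cases j <;> simp <;> omega⟩
  invFun r := ⟨(r.1.1, !![0, r.1.2; -r.1.2, 0]), by
    constructor
    · ext i j
      fin_cases i <;> fin_cases j <;> simp
    · intro h
      obtain ⟨hm, hM⟩ := Prod.ext_iff.1 h
      exact r.2 (Prod.ext hm (congrFun (congrFun hM 0) 1))⟩
  left_inv c := by
    obtain ⟨⟨m, M⟩, hM, hne⟩ := c
    have h' : ∀ i j, M j i = -M i j := fun i j => congrFun (congrFun hM i) j
    refine Subtype.ext (Prod.ext rfl (Matrix.ext fun i j => ?_))
    have a00 := h' 0 0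
    have a11 := h' 1 1
    have a01 := h' 0 1
    fin_cases i <;> fin_cases j <;> simp <;> omega
  right_inv r := rfl

/-- The rank-two charge has one entry `m⁰¹`, the dressing is `m + m⁰¹ B₀₁`, and the quartic
contraction with `g` reduces to `det g (m⁰¹)²`. The modulus is therefore `B₀₁ + i V`. -/
theorem isRegularizedEis_conjSpinor_two (hg : g.PosDef) (hB : B.transpose = -B) :
    IsRegularizedEisAtOne (conjSpinorMass g B)
      (Real.pi * regTheta (B 0 1) (vol g) + (gammaConst : ℂ)) := by
  obtain ⟨b0, b1, b2⟩ := antisymm_two hB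
  have hV := vol_pos hg
  refine isRegularizedEisAtOne_of_qform conjSpinorEquiv _ hV fun c => ?_
  have he : (conjSpinorEquiv c).1 = (c.1.1, c.1.2 0 1) := rfl
  have h' : ∀ i j, c.1.2 j i = -c.1.2 i j := fun i j => congrFun (congrFun c.2.1 i) j
  have a00 : c.1.2 0 0 = 0 := by have := h' 0 0; omega
  have a11 : c.1.2 1 1 = 0 := by have := h' 1 1; omega
  have a10 := h' 0 1
  rw [he, conjSpinorMass, qform, vol_two_sq hg]
  simp only [Fin.sum_univ_two, symm_of_posDef hg, a00, a11, a10, b0, b1, b2]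
  push_cast
  ring

end OneLoop

theorem proposition3 :
    -- `d = 1`: the integral and both series converge
    (∀ g B : Matrix (Fin 1) (Fin 1) ℝ, g.PosDef → B.transpose = -B →
      IntegrableOn (OneLoop.Z g B) ModularGroup.fd ∧
      Summable (OneLoop.eisTerm (OneLoop.spinorMass g) 1) ∧
      Summable (OneLoop.eisTerm (OneLoop.conjSpinorMass g B) 1) ∧
      OneLoop.modularIntegral g B =
        2 * OneLoop.eis (OneLoop.spinorMass g) 1 +
          2 * OneLoop.eis (OneLoop.conjSpinorMass g B) 1) ∧
    -- `d = 2`: both sides are regularized, and agree up to a constant independent of `g` and `B`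
    (∃ c : ℝ, ∀ g B : Matrix (Fin 2) (Fin 2) ℝ, g.PosDef → B.transpose = -B →
      ∃ I S C : ℂ,
        OneLoop.IsRegularizedIntegral g B I ∧
        OneLoop.IsRegularizedEisAtOne (OneLoop.spinorMass g) S ∧
        OneLoop.IsRegularizedEisAtOne (OneLoop.conjSpinorMass g B) C ∧
        I = 2 * S + 2 * C + (c : ℂ)) := by
  refine ⟨fun g B hg hB => ?_, ?_⟩
  · obtain ⟨i1, i2⟩ := OneLoop.modularIntegral_one hg hB
    have hS := OneLoop.hasSum_eis_spinor_one hg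
    have hC := OneLoop.hasSum_eis_conjSpinor_one (B := B) hg
    refine ⟨i1, hS.summable, hC.summable, ?_⟩
    rw [i2, OneLoop.eis, OneLoop.eis, hS.tsum_eq, hC.tsum_eq]
    push_cast
    ring
  · obtain ⟨c₀, hc₀⟩ := OneLoop.thetaDualConst_eq_ofReal
    -- The integral carries `-2π thetaDualConst`, and `2 S + 2 C` carries `4 gammaConst`, two from
    -- each series.
    refine ⟨-2 * Real.pi * c₀ - 4 * OneLoop.gammaConst, fun g B hg hB =>
      ⟨_, _, _, OneLoop.isRegularizedIntegral_two hg hB, OneLoop.isRegularizedEis_spinor_two hg,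
        OneLoop.isRegularizedEis_conjSpinor_two hg hB, ?_⟩⟩
    rw [hc₀]
    push_cast
    ring

end
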